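/- Let $m\ge 1$ be an integer, and let $\xi(x)$, $x\in\mathbb{R}^2$, be a (jointly) measurable, mean-square continuous, zero-mean, homogeneous and isotropic real-valued Gaussian random field (so that $\mathbb{E}\,\xi(x)\xi(y)$ depends only on $\|x-y\|$), whose covariance function $B(x)=\mathbb{E}\,\xi(0)\xi(x)$ satisfies $B(0)=1$ and $$B(x)=\|x\|^{-\alpha}L(\|x\|)\quad (x\neq 0),\qquad 0<\alpha<\frac{2}{m},$$ where $L:(0,\infty)\to(0,\infty)$ is measurable and slowly varying at infinity, i.e. $L(tr)/L(r)\to1$ as $r\to\infty$ for every $t>0$. Let $H_m(x)=(-1)^m e^{x^2/2}\frac{d^m}{dx^m}e^{-x^2/2}$ be the $m$-th Hermite polynomial. Let $g:\mathbb{R}^2\to\mathbb{R}$ be a measurable function such that $T^{4-\alpha m}g^2(T,T)L^m(T)\to\infty$ as $T\to\infty$, and such that there is a function $g^*$, Riemann integrable on $[0,1]^2$ (bounded there and continuous at almost every point of the square, as a function on the square), with $$\sup_{u,v\in[0,1]}\left|\frac{g(Tu,Tv)}{g(T,T)}-g^*(u,v)\right|\to 0,\qquad T\to\infty.$$ Let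 $T_1,T_2\ge0$ vary in such a way that $\tilde T=\max(T_1,T_2)\to\infty$ and the limits $\lim T_i/\tilde T$, $i=1,2$, exist. Then $g(t)H_m(\xi(t))$ is almost surely integrable over each rectangle $[0,T_1]\times[0,T_2]$, the difference in the brackets below is square integrable, and $$\lim_{\tilde T\to\infty}\frac{\mathbb{E}\left[\displaystyle\int_0^{T_1}\!\!\int_0^{T_2}g(t_1,t_2)H_m(\xi(t_1,t_2))\,dt_2\,dt_1-\sum_{i=0}^{[T_1]-1}\sum_{j=0}^{[T_2]-1}g(i,j)H_m(\xi(i,j))\right]^2}{\tilde T^{\,4-\alpha m}\,g^2(\tilde T,\tilde T)\,L^m(\tilde T)}=0,$$ where $[T]$ is the integer part of $T$ and an empty sum is $0$. -/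

import Mathlib

open MeasureTheory ProbabilityTheory Filter Topology Set

/-- The Euclidean plane. -/
abbrev Plane : Type := EuclideanSpace ℝ (Fin 2)

/-- A measurable function `L : (0,∞) → (0,∞)` which is slowly varying at infinity.
Only the values of `L` on `(0,∞)` matter. -/
structure SlowlyVarying (L : ℝ → ℝ) : Prop where
  measurable : Measurable (fun r : Ioi (0 : ℝ) => L r)
  pos : ∀ r : ℝ, 0 < r → 0 < L r
  tendsto_ratio : ∀ t : ℝ, 0 < t → Tendsto (fun r : ℝ => L (t * r) / L r) atTop (𝓝 1)

/-- A (jointly) measurable, mean-square continuous, zero-mean, homogeneous and isotropic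
real-valued Gaussian random field on the plane. -/
structure IsHomogeneousIsotropicGaussianField {Ω : Type*} [MeasurableSpace Ω]
    (ξ : Plane → Ω → ℝ) (P : Measure Ω) : Prop where
  measurable : Measurable (fun p : Plane × Ω => ξ p.1 p.2)
  gaussian : IsGaussianProcess ξ P
  mean_zero : ∀ x, ∫ ω, ξ x ω ∂P = 0
  /-- the covariance of `ξ x` and `ξ y` depends only on the distance from `x` to `y` -/
  homogeneous_isotropic : ∀ x y x' y' : Plane, dist x y = dist x' y' →
    ∫ ω, ξ x ω * ξ y ω ∂P = ∫ ω, ξ x' ω * ξ y' ω ∂P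
  meanSquare_continuous : ∀ x,
    Tendsto (fun y => ∫ ω, (ξ y ω - ξ x ω) ^ 2 ∂P) (𝓝 x) (𝓝 0)

/-- The covariance function `B(x) = E (ξ(0) ξ(x))` satisfies `B(0) = 1` and
`B(x) = ‖x‖^(-α) L(‖x‖)` for `x ≠ 0`, with `α > 0` and `L` slowly varying at infinity. -/
structure HasRegularlyVaryingCovariance {Ω : Type*} [MeasurableSpace Ω]
    (ξ : Plane → Ω → ℝ) (P : Measure Ω) (α : ℝ) (L : ℝ → ℝ) : Prop where
  exponent_pos : 0 < α
  slowlyVarying : SlowlyVarying L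
  cov_zero : ∫ ω, ξ 0 ω * ξ 0 ω ∂P = 1
  cov_eq : ∀ x : Plane, x ≠ 0 → ∫ ω, ξ 0 ω * ξ x ω ∂P = ‖x‖ ^ (-α) * L ‖x‖

/-- The closed unit square. -/
def unitSquare : Set (ℝ × ℝ) := Icc 0 1 ×ˢ Icc 0 1

/-- The assumption on the weight `g`: non-degeneracy of the normalization, and uniform
convergence on the unit square of `g(Tu,Tv) / g(T,T)` to `gstar(u,v)`. Here `g` is measurable and
`gstar` is Riemann integrable on the unit square, that is, bounded and continuous
almost everywhere there. -/
structure IsAdmissibleWeight (m : ℕ) (α : ℝ) (L : ℝ → ℝ) (g gstar : ℝ → ℝ → ℝ) : Prop where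
  measurable : Measurable (fun p : ℝ × ℝ => g p.1 p.2)
  nondegenerate :
    Tendsto (fun T : ℝ => T ^ (4 - α * m) * g T T ^ 2 * L T ^ m) atTop atTop
  tendsto_uniformly :
    TendstoUniformlyOn (fun (T : ℝ) (p : ℝ × ℝ) => g (T * p.1) (T * p.2) / g T T)
      (fun p : ℝ × ℝ => gstar p.1 p.2) atTop unitSquare
  limit_bounded : ∃ C : ℝ, ∀ p ∈ unitSquare, |gstar p.1 p.2| ≤ C
  limit_ae_continuous : ∀ᵐ p ∂((volume : Measure (ℝ × ℝ)).restrict unitSquare),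
    ContinuousWithinAt (fun p : ℝ × ℝ => gstar p.1 p.2) unitSquare p

/-- The value `g(t₁,t₂) H_m(ξ(t₁,t₂))` at `ω`, with `H_m` the probabilists' Hermite polynomial
(leading coefficient one). -/
noncomputable def weightedHermite {Ω : Type*} (m : ℕ) (g : ℝ → ℝ → ℝ) (ξ : Plane → Ω → ℝ)
    (t₁ t₂ : ℝ) (ω : Ω) : ℝ :=
  g t₁ t₂ * Polynomial.aeval (ξ !₂[t₁, t₂] ω) (Polynomial.hermite m)

/-- The weighted integral `∫₀^{T₁} ∫₀^{T₂} g(t₁,t₂) H_m(ξ(t₁,t₂)) dt₂ dt₁`. -/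
noncomputable def integralFunctional {Ω : Type*} (m : ℕ) (g : ℝ → ℝ → ℝ) (ξ : Plane → Ω → ℝ)
    (T₁ T₂ : ℝ) (ω : Ω) : ℝ :=
  ∫ t₁ in (0 : ℝ)..T₁, ∫ t₂ in (0 : ℝ)..T₂, weightedHermite m g ξ t₁ t₂ ω

/-- The lattice sum `∑_{i=0}^{[T₁]-1} ∑_{j=0}^{[T₂]-1} g(i,j) H_m(ξ(i,j))`. -/
noncomputable def additiveFunctional {Ω : Type*} (m : ℕ) (g : ℝ → ℝ → ℝ) (ξ : Plane → Ω → ℝ)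
    (T₁ T₂ : ℝ) (ω : Ω) : ℝ :=
  ∑ i ∈ Finset.range ⌊T₁⌋₊, ∑ j ∈ Finset.range ⌊T₂⌋₊, weightedHermite m g ξ (i : ℝ) (j : ℝ) ω

/-!
The mean square distance of the two functionals is expanded as `E I² - 2 E (I S) + E S²`, and each
of the three terms, divided by the normalization, has the same limit.

The lattice sum `S` is itself an integral: it integrates `g(π t) H_m(ξ(π t))` over a union of unit
cells, where `π t` is the lower left corner of the cell of `t`, while `I` is the same expression
with `π = id`. Since `E (H_m(X) H_m(Y)) = m! (E X Y) ^ m` for jointly Gaussian standard variables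
(`integral_hermite_mul_hermite`, by Gaussian integration by parts), Fubini's theorem turns each of
the three terms into a double integral of weights against the `m`-th power of the covariance. After
the substitution `t = T u` with `T = max T₁ T₂` it becomes a quadratic form over the unit square in
the rescaled correlation `T ^ α B(T ·) / L(T)` (`integral_sampledFunctional_mul_div`).

Dominated convergence gives the limit of these forms (`IsAsymptoticSampling.tendsto_integral`). The
rescaled weights converge to `g*` times the indicator of the limiting rectangle at almost every
point, because the sampled points lie within `1 / T` of the original ones and `g*` is almost
everywhere continuous. The rescaled correlations converge to `‖u - v‖ ^ (-α)`, because slow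
variation is locally uniform. The majorant is a multiple of `‖u - v‖ ^ (-(α + δ))`, from Potter's
bound at distances larger than a multiple of `1 / T` and from `B ≤ 1` at smaller ones
(`IsRegularlyVaryingCorrelation.exists_rescaled_le`); its `m`-th power is integrable over the square
of the unit square when `(α + δ) m < 2`, which `α < 2 / m` permits. Potter's bound is derived from
the pointwise definition of slow variation by a Baire category argument
(`exists_forall_abs_increment_le`), for which `L` is continuous because the covariance is.
-/

/-! ### Hermite polynomials of jointly Gaussian variables -/

/-- The `m`-th probabilists' Hermite polynomial with real coefficients. -/
noncomputable def hermiteReal (m : ℕ) : Polynomial ℝ :=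
  (Polynomial.hermite m).map (Int.castRingHom ℝ)

lemma aeval_hermite_eq_eval (m : ℕ) (x : ℝ) :
    Polynomial.aeval x (Polynomial.hermite m) = (hermiteReal m).eval x := by
  rw [hermiteReal, Polynomial.aeval_def, Polynomial.eval₂_eq_eval_map]
  rfl

lemma hermiteReal_succ (m : ℕ) :
    hermiteReal (m + 1) = Polynomial.X * hermiteReal m - (hermiteReal m).derivative := by
  simp [hermiteReal, Polynomial.hermite_succ, Polynomial.derivative_map]

lemma derivative_hermiteReal_succ (m : ℕ) :
    (hermiteReal (m + 1)).derivative = Polynomial.C ((m : ℝ) + 1) * hermiteReal m := by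
  induction m with
  | zero => simp [hermiteReal]
  | succ m ih =>
    rw [hermiteReal_succ (m + 1), Polynomial.derivative_sub, Polynomial.derivative_mul, ih,
      Polynomial.derivative_mul, Polynomial.derivative_C, Polynomial.derivative_X]
    rw [hermiteReal_succ m]
    push_cast
    simp only [Polynomial.C_add, Polynomial.C_1]
    ring

/-- A polynomial in a random variable with finite moments has finite moments. -/
lemma memLp_eval_polynomial {Ω : Type*} [MeasurableSpace Ω] {P : Measure Ω} [IsFiniteMeasure P]
    {f : Ω → ℝ} (hf : ∀ r : ENNReal, r ≠ ⊤ → MemLp f r P) (p : Polynomial ℝ) :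
    ∀ r : ENNReal, r ≠ ⊤ → MemLp (fun ω => p.eval (f ω)) r P := by
  have hmul : ∀ {u v : Ω → ℝ}, (∀ r : ENNReal, r ≠ ⊤ → MemLp u r P) →
      (∀ r : ENNReal, r ≠ ⊤ → MemLp v r P) →
      ∀ r : ENNReal, r ≠ ⊤ → MemLp (fun ω => u ω * v ω) r P := by
    intro u v hu hv r hr
    have h2 : (2 : ENNReal) * r ≠ ⊤ := ENNReal.mul_ne_top (by simp) hr
    have : ENNReal.HolderTriple (2 * r) (2 * r) r := ⟨by
      rw [ENNReal.mul_inv (by simp) (by simp), ← add_mul, ENNReal.inv_two_add_inv_two, one_mul]⟩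
    exact (hv _ h2).mul (hu _ h2)
  induction p using Polynomial.induction_on' with
  | add p q hp hq =>
    intro r hr
    simp only [Polynomial.eval_add]
    exact (hp r hr).add (hq r hr)
  | monomial n a =>
    have hpow : ∀ n : ℕ, ∀ r : ENNReal, r ≠ ⊤ → MemLp (fun ω => f ω ^ n) r P := by
      intro n
      induction n with
      | zero => intro r _; simpa using memLp_const (1 : ℝ)
      | succ n ih => simpa [pow_succ] using hmul ih hf
    intro r hr
    simpa using (hpow n r hr).const_mul a

/-- Gaussian integration by parts for polynomials: `E (X p(X)) = E p'(X)` for a standard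
normal `X`. -/
lemma integral_mul_eval_gaussianReal (p : Polynomial ℝ) :
    ∫ x, x * p.eval x ∂(gaussianReal 0 1) = ∫ x, p.derivative.eval x ∂(gaussianReal 0 1) := by
  have hint : ∀ q : Polynomial ℝ, Integrable (fun x => q.eval x * gaussianPDFReal 0 1 x) := by
    intro q
    have h1 : Integrable (fun x => q.eval x) (gaussianReal 0 1) :=
      (memLp_eval_polynomial (f := fun x => x)
        (fun r hr => memLp_id_gaussianReal' r hr) q 1 (by simp)).integrable le_rfl
    rw [gaussianReal_of_var_ne_zero _ (one_ne_zero), integrable_withDensity_iff_integrable_smul'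
      (measurable_gaussianPDF 0 1) (by simp [gaussianPDF_lt_top])] at h1
    simpa [toReal_gaussianPDF, mul_comm] using h1
  have hv : ∀ x, HasDerivAt (gaussianPDFReal 0 1) (-x * gaussianPDFReal 0 1 x) x := by
    intro x
    have h : HasDerivAt (fun x : ℝ => -(x - 0) ^ 2 / (2 * ((1 : NNReal) : ℝ))) (-x) x := by
      have := (((hasDerivAt_id x).sub_const 0).pow 2).neg.div_const (2 * ((1 : NNReal) : ℝ))
      convert! this using 1
      simp only [NNReal.coe_one, id]
      ring
    have h2 := (h.exp).const_mul (√(2 * Real.pi * ((1 : NNReal) : ℝ)))⁻¹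
    rw [gaussianPDFReal_def]
    convert! h2 using 1
    ring
  have key := integral_mul_deriv_eq_deriv_mul_of_integrable (u := fun x => p.eval x)
    (u' := fun x => p.derivative.eval x) (fun x _ => p.hasDerivAt x)
    (fun x _ => hv x) ((hint (-(p * Polynomial.X))).congr (ae_of_all _ fun x => by
      simp only [Polynomial.eval_neg, Polynomial.eval_mul, Polynomial.eval_X, Pi.mul_apply]; ring))
    (hint _) (hint _)
  rw [integral_gaussianReal_eq_integral_smul one_ne_zero,
    integral_gaussianReal_eq_integral_smul one_ne_zero]
  have e1 : ∫ x, p.eval x * (-x * gaussianPDFReal 0 1 x)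
      = -∫ x, gaussianPDFReal 0 1 x • (x * p.eval x) := by
    rw [← integral_neg]
    congr 1 with x
    simp only [smul_eq_mul]; ring
  rw [e1] at key
  rw [neg_injective key]
  simp [mul_comm]

section JointlyGaussian

variable {Ω : Type*} [MeasurableSpace Ω] {P : Measure Ω} {X Y : Ω → ℝ}

lemma memLp_eval_of_hasGaussianLaw [IsFiniteMeasure P] (hX : HasGaussianLaw X P)
    (p : Polynomial ℝ) {r : ENNReal} (hr : r ≠ ⊤) : MemLp (fun ω => p.eval (X ω)) r P :=
  memLp_eval_polynomial (fun _ hr => hX.memLp hr) p r hr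

lemma integrable_eval_mul_eval [IsFiniteMeasure P] (hX : HasGaussianLaw X P)
    (hY : HasGaussianLaw Y P) (p q : Polynomial ℝ) :
    Integrable (fun ω => p.eval (X ω) * q.eval (Y ω)) P :=
  (memLp_eval_of_hasGaussianLaw hX p (by simp : (2 : ENNReal) ≠ ⊤)).integrable_mul
    (memLp_eval_of_hasGaussianLaw hY q (by simp : (2 : ENNReal) ≠ ⊤))

/-- Gaussian integration by parts for two jointly Gaussian variables. The proof splits `Y` as
`ρ X + W` with `ρ` the covariance and `W` independent of `X`, and integrates by parts in `X` for
fixed `W`. -/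
lemma integral_mul_eval_mul_eval [IsProbabilityMeasure P]
    (hXY : HasGaussianLaw (fun ω => (X ω, Y ω)) P)
    (hX0 : ∫ ω, X ω ∂P = 0) (hX1 : ∫ ω, X ω * X ω ∂P = 1)
    (p q : Polynomial ℝ) :
    ∫ ω, X ω * p.eval (X ω) * q.eval (Y ω) ∂P
      = ∫ ω, p.derivative.eval (X ω) * q.eval (Y ω) ∂P
        + (∫ ω, X ω * Y ω ∂P) * ∫ ω, p.eval (X ω) * q.derivative.eval (Y ω) ∂P := by
  set ρ := ∫ ω, X ω * Y ω ∂P with hρ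
  set W : Ω → ℝ := fun ω => Y ω - ρ * X ω with hW
  have hX := hXY.fst
  have hY := hXY.snd
  have hXm : MemLp X 2 P := hX.memLp_two
  have hYm : MemLp Y 2 P := hY.memLp_two
  have hXW : HasGaussianLaw (fun ω => (X ω, W ω)) P := by
    have := hXY.map_fun ((ContinuousLinearMap.fst ℝ ℝ ℝ).prod
      (ContinuousLinearMap.snd ℝ ℝ ℝ - ρ • ContinuousLinearMap.fst ℝ ℝ ℝ))
    simpa [hW] using this
  have hWG := hXW.snd
  have hcov : cov[X, W; P] = 0 := by
    rw [covariance_eq_sub hXm hWG.memLp_two]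
    simp only [hX0, zero_mul, sub_zero, Pi.mul_apply, hW]
    have : ∀ ω, X ω * (Y ω - ρ * X ω) = X ω * Y ω - ρ * (X ω * X ω) := fun ω => by ring
    simp_rw [this]
    have i1 : Integrable (fun ω => X ω * Y ω) P := hXm.integrable_mul hYm
    have i2 : Integrable (fun ω => X ω * X ω) P := hXm.integrable_mul hXm
    rw [integral_sub i1 (i2.const_mul ρ), integral_const_mul, hX1, ← hρ]
    ring
  have hind : IndepFun X W P := hXW.indepFun_of_covariance_eq_zero hcov
  have hlaw : P.map X = gaussianReal 0 1 := by
    rw [hX.map_eq_gaussianReal, hX0, variance_eq_sub hXm, hX0]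
    have : P[X ^ 2] = 1 := by rw [← hX1]; congr 1 with ω; simp [pow_two]
    rw [this]
    simp
  have hXa := hX.aemeasurable
  have hWa := hWG.aemeasurable
  have hpair : P.map (fun ω => (X ω, W ω)) = (gaussianReal 0 1).prod (P.map W) := by
    rw [← hlaw]
    exact (indepFun_iff_map_prod_eq_prod_map_map hXa hWa).1 hind
  have : IsProbabilityMeasure (P.map W) := Measure.isProbabilityMeasure_map hWa
  -- a product of polynomials in `X` and `Y`, integrated over `W` last
  have key : ∀ a b : Polynomial ℝ,
      Integrable (fun z : ℝ × ℝ => a.eval z.1 * b.eval (z.2 + ρ * z.1))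
        ((gaussianReal 0 1).prod (P.map W)) ∧
      ∫ ω, a.eval (X ω) * b.eval (Y ω) ∂P
        = ∫ w, ∫ x, a.eval x * b.eval (w + ρ * x) ∂(gaussianReal 0 1) ∂(P.map W) := by
    intro a b
    have hm : AEStronglyMeasurable (fun z : ℝ × ℝ => a.eval z.1 * b.eval (z.2 + ρ * z.1))
        (P.map (fun ω => (X ω, W ω))) := by
      apply Continuous.aestronglyMeasurable
      exact (a.continuous.comp continuous_fst).mul (b.continuous.comp (by fun_prop))
    have hpm : AEMeasurable (fun ω => (X ω, W ω)) P := hXa.prodMk hWa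
    have hi : Integrable (fun z : ℝ × ℝ => a.eval z.1 * b.eval (z.2 + ρ * z.1))
        ((gaussianReal 0 1).prod (P.map W)) := by
      rw [← hpair, integrable_map_measure hm hpm]
      refine (integrable_eval_mul_eval hX hY a b).congr (ae_of_all _ fun ω => ?_)
      simp [hW]
    refine ⟨hi, ?_⟩
    rw [← integral_prod_symm _ hi, ← hpair, integral_map hpm hm]
    simp [hW]
  have h1 := (key (Polynomial.X * p) q).2
  obtain ⟨i2, h2⟩ := key p.derivative q
  obtain ⟨i3, h3⟩ := key p q.derivative
  simp only [Polynomial.eval_mul, Polynomial.eval_X] at h1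
  rw [h1, h2, h3, ← integral_const_mul,
    ← integral_add i2.integral_prod_right (i3.integral_prod_right.const_mul ρ)]
  refine integral_congr_ae ?_
  filter_upwards [i2.prod_left_ae, i3.prod_left_ae] with w hw2 hw3
  have h := integral_mul_eval_gaussianReal
    (p * q.comp (Polynomial.C w + Polynomial.C ρ * Polynomial.X))
  simp only [Polynomial.eval_mul, Polynomial.eval_comp, Polynomial.eval_add, Polynomial.eval_C,
    Polynomial.eval_X, Polynomial.derivative_mul, Polynomial.derivative_comp,
    Polynomial.derivative_add, Polynomial.derivative_C, Polynomial.derivative_X, zero_add,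
    zero_mul, mul_one] at h
  rw [← integral_const_mul, ← integral_add hw2 (hw3.const_mul ρ)]
  simp only [mul_assoc]
  rw [h]
  congr 1 with x
  ring

/-- The covariance of Hermite polynomials of jointly Gaussian standard variables:
`E (H_m(X) H_m(Y)) = m! (E X Y) ^ m`. -/
lemma integral_hermite_mul_hermite [IsProbabilityMeasure P]
    (hXY : HasGaussianLaw (fun ω => (X ω, Y ω)) P)
    (hX0 : ∫ ω, X ω ∂P = 0) (hX1 : ∫ ω, X ω * X ω ∂P = 1) (m : ℕ) :
    ∫ ω, (hermiteReal m).eval (X ω) * (hermiteReal m).eval (Y ω) ∂P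
      = m.factorial * (∫ ω, X ω * Y ω ∂P) ^ m := by
  induction m with
  | zero => simp [hermiteReal]
  | succ m ih =>
    have h := integral_mul_eval_mul_eval hXY hX0 hX1 (hermiteReal m) (hermiteReal (m + 1))
    have i := integrable_eval_mul_eval hXY.fst hXY.snd
    have e : ∀ ω, (hermiteReal (m + 1)).eval (X ω) * (hermiteReal (m + 1)).eval (Y ω)
        = X ω * (hermiteReal m).eval (X ω) * (hermiteReal (m + 1)).eval (Y ω)
          - (hermiteReal m).derivative.eval (X ω) * (hermiteReal (m + 1)).eval (Y ω) := by
      intro ω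
      rw [← sub_mul]
      congr 1
      simp [hermiteReal_succ m]
    have i1 := i (Polynomial.X * hermiteReal m) (hermiteReal (m + 1))
    simp only [Polynomial.eval_mul, Polynomial.eval_X] at i1
    simp_rw [e]
    rw [integral_sub i1 (i _ _), h, derivative_hermiteReal_succ]
    simp only [Polynomial.eval_mul, Polynomial.eval_C]
    have e2 : ∀ ω, (hermiteReal m).eval (X ω) * (((m : ℝ) + 1) * (hermiteReal m).eval (Y ω))
        = ((m : ℝ) + 1) * ((hermiteReal m).eval (X ω) * (hermiteReal m).eval (Y ω)) :=
      fun ω => by ring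
    simp_rw [e2]
    rw [integral_const_mul, ih, Nat.factorial_succ]
    push_cast
    ring

end JointlyGaussian

/-! ### Slowly varying functions -/

/-- If all increments `h (x + u) - h x` of a continuous function tend to zero as `x → ∞`, then they
do so uniformly in `u ∈ [0, 1]`. By the Baire category theorem the increments are small for all `u`
in some interval and all large `x`; finitely many fixed increments then cover `[0, 1]`. -/
lemma exists_forall_abs_increment_le {h : ℝ → ℝ} (hc : Continuous h)
    (hh : ∀ u, Tendsto (fun x => h (x + u) - h x) atTop (𝓝 0)) {ε : ℝ} (hε : 0 < ε) :
    ∃ X, ∀ x, X ≤ x → ∀ u ∈ Icc (0 : ℝ) 1, |h (x + u) - h x| ≤ ε := by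
  have hε3 : 0 < ε / 3 := by positivity
  let F : ℕ → Set ℝ := fun n => {u | ∀ x : ℝ, (n : ℝ) ≤ x → |h (x + u) - h x| ≤ ε / 3}
  have hF : ∀ n, IsClosed (F n) := by
    intro n
    simp only [F, ofPred_forall]
    refine isClosed_iInter fun x => isClosed_iInter fun _ => ?_
    exact isClosed_le (by fun_prop) continuous_const
  have hU : ⋃ n, F n = univ := by
    refine eq_univ_of_forall fun u => mem_iUnion.2 ?_
    obtain ⟨X, hX⟩ := eventually_atTop.1 ((tendsto_order.1 (hh u).abs).2 (ε / 3) (by simpa))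
    obtain ⟨n, hn⟩ := exists_nat_ge X
    exact ⟨n, fun x hx => (hX x (hn.trans hx)).le⟩
  obtain ⟨n, a, ha⟩ := nonempty_interior_of_iUnion_of_closed hF hU
  obtain ⟨r, hr, hball⟩ := Metric.isOpen_iff.1 isOpen_interior a ha
  have hmem : ∀ w, 0 ≤ w → w ≤ r / 2 → a + w ∈ F n := fun w h0 h1 =>
    interior_subset (hball (by
      rw [Metric.mem_ball, Real.dist_eq, add_sub_cancel_left, abs_of_nonneg h0]; linarith))
  have hsmall : ∀ y, (n : ℝ) + a ≤ y → ∀ w, 0 ≤ w → w ≤ r / 2 →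
      |h (y + w) - h y| ≤ 2 * (ε / 3) := by
    intro y hy w h0 h1
    have h2 := hmem w h0 h1 (y - a) (by linarith)
    have h3 := hmem 0 le_rfl (by positivity) (y - a) (by linarith)
    rw [show y - a + (a + w) = y + w by ring] at h2
    rw [show y - a + (a + 0) = y by ring] at h3
    rw [abs_le] at *
    constructor <;> linarith [h2.1, h2.2, h3.1, h3.2]
  obtain ⟨N, hN⟩ := exists_nat_ge (1 / (r / 2))
  have hev : ∀ᶠ x in atTop, ∀ k ∈ Finset.range (N + 1), |h (x + k * (r / 2)) - h x| ≤ ε / 3 := by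
    rw [Filter.eventually_all_finset]
    intro k _
    exact ((tendsto_order.1 (hh (k * (r / 2))).abs).2 (ε / 3) (by simpa)).mono fun x hx => hx.le
  obtain ⟨X, hX⟩ := eventually_atTop.1 hev
  refine ⟨max X (n + a), fun x hx u hu => ?_⟩
  have hr2 : 0 < r / 2 := by positivity
  have hk0 : (⌊u / (r / 2)⌋₊ : ℝ) ≤ u / (r / 2) := Nat.floor_le (div_nonneg hu.1 hr2.le)
  have hk1 := Nat.lt_floor_add_one (u / (r / 2))
  set k := ⌊u / (r / 2)⌋₊
  rw [le_div_iff₀ hr2] at hk0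
  rw [div_lt_iff₀ hr2] at hk1
  have hkN : k ∈ Finset.range (N + 1) := by
    rw [Finset.mem_range, Nat.lt_succ_iff]
    have : (k : ℝ) ≤ 1 / (r / 2) := by rw [le_div_iff₀ hr2]; exact hk0.trans hu.2
    exact_mod_cast this.trans hN
  have h1 := hX x ((le_max_left _ _).trans hx) k hkN
  have h2 := hsmall (x + k * (r / 2))
    (by linarith [(le_max_right X ((n : ℝ) + a)).trans hx, mul_nonneg (Nat.cast_nonneg k) hr2.le])
    (u - k * (r / 2)) (by linarith) (by linarith)
  rw [show x + k * (r / 2) + (u - k * (r / 2)) = x + u by ring] at h2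
  rw [abs_le] at *
  constructor <;> linarith [h1.1, h1.2, h2.1, h2.2]

/-- Increments of `h` far out grow at most linearly, with an arbitrarily small slope. -/
lemma exists_forall_abs_sub_le {h : ℝ → ℝ} (hc : Continuous h)
    (hh : ∀ u, Tendsto (fun x => h (x + u) - h x) atTop (𝓝 0)) {δ : ℝ} (hδ : 0 < δ) :
    ∃ X, ∀ x y, X ≤ x → X ≤ y → |h y - h x| ≤ δ * (|y - x| + 1) := by
  obtain ⟨X, hX⟩ := exists_forall_abs_increment_le hc hh hδ
  have hn : ∀ (n : ℕ) x, X ≤ x → |h (x + n) - h x| ≤ δ * n := by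
    intro n
    induction n with
    | zero => intro x _; simp
    | succ n ih =>
      intro x hx
      have h1 := ih x hx
      have h2 := hX (x + n) (by linarith [(Nat.cast_nonneg n : (0 : ℝ) ≤ n)]) 1 (by simp)
      rw [show x + n + 1 = x + ((n + 1 : ℕ) : ℝ) by push_cast; ring] at h2
      rw [abs_le] at *
      push_cast at *
      constructor <;> linarith [h1.1, h1.2, h2.1, h2.2]
  have hle : ∀ x y, X ≤ x → x ≤ y → |h y - h x| ≤ δ * (|y - x| + 1) := by
    intro x y hx hxy
    have h0 := sub_nonneg.2 hxy
    have hf := Nat.floor_le h0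
    have hf' := Nat.lt_floor_add_one (y - x)
    set n := ⌊y - x⌋₊
    have h1 := hn n x hx
    have h2 := hX (x + n) (by linarith [(Nat.cast_nonneg n : (0 : ℝ) ≤ n)]) (y - x - n)
      ⟨by linarith, by linarith⟩
    rw [show x + n + (y - x - n) = y by ring] at h2
    rw [abs_of_nonneg h0]
    have h3 : δ * n ≤ δ * (y - x) := by gcongr
    rw [abs_le] at *
    constructor <;> linarith [h1.1, h1.2, h2.1, h2.2]
  refine ⟨X, fun x y hx hy => ?_⟩
  rcases le_total x y with hxy | hxy
  · exact hle x y hx hxy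
  · rw [abs_sub_comm, abs_sub_comm y x]
    exact hle y x hy hxy

namespace SlowlyVarying

variable {L : ℝ → ℝ}

/-- Potter's bound in logarithmic form. -/
lemma exists_abs_log_sub_le (hL : SlowlyVarying L) (hc : ContinuousOn L (Ioi 0)) {δ : ℝ}
    (hδ : 0 < δ) :
    ∃ R, 0 < R ∧ ∀ r s, R ≤ r → R ≤ s →
      |Real.log (L r) - Real.log (L s)| ≤ δ * (|Real.log r - Real.log s| + 1) := by
  have hpos : ∀ x, 0 < L (Real.exp x) := fun x => hL.pos _ (Real.exp_pos x)
  have hcont : Continuous (fun x => Real.log (L (Real.exp x))) :=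
    (hc.comp_continuous Real.continuous_exp fun x => Real.exp_pos x).log fun x => (hpos x).ne'
  obtain ⟨X, hX⟩ := exists_forall_abs_sub_le hcont (fun u => by
    have h1 := (hL.tendsto_ratio _ (Real.exp_pos u)).comp Real.tendsto_exp_atTop
    have h2 := h1.log one_ne_zero
    rw [Real.log_one] at h2
    refine h2.congr fun x => ?_
    simp only [Function.comp]
    rw [← Real.exp_add, add_comm u x, Real.log_div (hpos _).ne' (hpos _).ne']) hδ
  refine ⟨Real.exp X, Real.exp_pos X, fun r s hr hs => ?_⟩
  have hr0 := (Real.exp_pos X).trans_le hr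
  have hs0 := (Real.exp_pos X).trans_le hs
  have h := hX (Real.log s) (Real.log r) ((Real.le_log_iff_exp_le hs0).2 hs)
    ((Real.le_log_iff_exp_le hr0).2 hr)
  rwa [Real.exp_log hr0, Real.exp_log hs0] at h

/-- Potter's bound for arguments `r ≤ K s`. -/
lemma exists_div_le_rpow (hL : SlowlyVarying L) (hc : ContinuousOn L (Ioi 0)) {δ : ℝ}
    (hδ : 0 < δ) {K : ℝ} (hK : 1 ≤ K) :
    ∃ R C, 0 < R ∧ 0 < C ∧ ∀ r s, R ≤ r → R ≤ s → r ≤ K * s → L r / L s ≤ C * (s / r) ^ δ := by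
  obtain ⟨R, hR, h⟩ := hL.exists_abs_log_sub_le hc hδ
  refine ⟨R, Real.exp (δ * (2 * Real.log K + 1)), hR, Real.exp_pos _, fun r s hr hs hrs => ?_⟩
  have hr0 := hR.trans_le hr
  have hs0 := hR.trans_le hs
  have hK0 : 0 < K := by linarith
  have hlog : Real.log r ≤ Real.log K + Real.log s := by
    rw [← Real.log_mul hK0.ne' hs0.ne']
    exact Real.log_le_log hr0 hrs
  have hlK := Real.log_nonneg hK
  have habs : |Real.log r - Real.log s| ≤ Real.log s - Real.log r + 2 * Real.log K := by
    rw [abs_le]; constructor <;> linarith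
  have h1 : Real.log (L r / L s) ≤ δ * (Real.log s - Real.log r + 2 * Real.log K + 1) := by
    rw [Real.log_div (hL.pos r hr0).ne' (hL.pos s hs0).ne']
    refine (le_abs_self _).trans ((h r s hr hs).trans ?_)
    gcongr
  rw [Real.log_le_iff_le_exp (div_pos (hL.pos r hr0) (hL.pos s hs0))] at h1
  refine h1.trans_eq ?_
  rw [Real.rpow_def_of_pos (div_pos hs0 hr0), ← Real.exp_add,
    Real.log_div hs0.ne' hr0.ne']
  congr 1
  ring

/-- Slow variation is uniform: `L (T ρ_T) / L T → 1` whenever `ρ_T` has a positive limit. -/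
lemma tendsto_div_of_tendsto (hL : SlowlyVarying L) (hc : ContinuousOn L (Ioi 0))
    {ι : Type*} {l : Filter ι} {T ρ : ι → ℝ} {a : ℝ} (ha : 0 < a) (hT : Tendsto T l atTop)
    (hρ : Tendsto ρ l (𝓝 a)) : Tendsto (fun i => L (T i * ρ i) / L (T i)) l (𝓝 1) := by
  have hTρ : Tendsto (fun i => T i * ρ i) l atTop := hT.atTop_mul_pos ha hρ
  have hlog : Tendsto (fun i => Real.log (L (T i * ρ i)) - Real.log (L (T i))) l (𝓝 0) := by
    rw [Metric.tendsto_nhds]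
    intro ε hε
    set M := |Real.log a| + 1 + 1 with hM
    have hM0 : 0 < M := by positivity
    obtain ⟨R, hR, h⟩ := hL.exists_abs_log_sub_le hc (δ := ε / (2 * M)) (by positivity)
    have hρlog : ∀ᶠ i in l, |Real.log (ρ i)| < |Real.log a| + 1 :=
      (tendsto_order.1 (hρ.log ha.ne').abs).2 _ (by linarith)
    filter_upwards [hT.eventually_ge_atTop R, hTρ.eventually_ge_atTop R, hρlog,
      hρ.eventually_const_lt ha] with i h1 h2 h3 h4
    have h5 := h _ _ h2 h1
    rw [Real.log_mul (hR.trans_le h1).ne' h4.ne', add_sub_cancel_left] at h5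
    rw [Real.dist_eq, sub_zero]
    calc |Real.log (L (T i * ρ i)) - Real.log (L (T i))|
        ≤ ε / (2 * M) * (|Real.log (ρ i)| + 1) := h5
      _ ≤ ε / (2 * M) * M := by gcongr; linarith
      _ = ε / 2 := by field_simp
      _ < ε := by linarith
  have := hlog.rexp
  rw [Real.exp_zero] at this
  refine this.congr' ?_
  filter_upwards [hT.eventually_gt_atTop 0, hTρ.eventually_gt_atTop 0] with i h1 h2
  rw [Real.exp_sub, Real.exp_log (hL.pos _ h2), Real.exp_log (hL.pos _ h1)]

end SlowlyVarying

/-! ### The rescaled covariance kernel -/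

/-- The point of the Euclidean plane with the given coordinates. -/
noncomputable def planePoint (p : ℝ × ℝ) : Plane := !₂[p.1, p.2]

/-- The Euclidean distance on `ℝ × ℝ`, whose own `dist` is the sup distance. -/
noncomputable def euclidDist (p q : ℝ × ℝ) : ℝ := dist (planePoint p) (planePoint q)

lemma continuous_planePoint : Continuous planePoint := by
  unfold planePoint
  fun_prop

lemma continuous_euclidDist : Continuous fun z : (ℝ × ℝ) × (ℝ × ℝ) => euclidDist z.1 z.2 :=
  (continuous_planePoint.comp continuous_fst).dist (continuous_planePoint.comp continuous_snd)

lemma euclidDist_eq (p q : ℝ × ℝ) :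
    euclidDist p q = √((p.1 - q.1) ^ 2 + (p.2 - q.2) ^ 2) := by
  simp [euclidDist, planePoint, EuclideanSpace.dist_eq, Fin.sum_univ_two, Real.dist_eq, sq_abs]

lemma euclidDist_nonneg (p q : ℝ × ℝ) : 0 ≤ euclidDist p q := dist_nonneg

lemma dist_le_euclidDist (p q : ℝ × ℝ) : dist p q ≤ euclidDist p q := by
  rw [euclidDist_eq, Prod.dist_eq, Real.dist_eq, Real.dist_eq]
  refine max_le (Real.abs_le_sqrt ?_) (Real.abs_le_sqrt ?_)
  · linarith [sq_nonneg (p.2 - q.2)]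
  · linarith [sq_nonneg (p.1 - q.1)]

lemma euclidDist_le_two_mul_dist (p q : ℝ × ℝ) : euclidDist p q ≤ 2 * dist p q := by
  have h1 : |p.1 - q.1| ≤ dist p q := by rw [Prod.dist_eq, ← Real.dist_eq]; exact le_max_left _ _
  have h2 : |p.2 - q.2| ≤ dist p q := by rw [Prod.dist_eq, ← Real.dist_eq]; exact le_max_right _ _
  rw [euclidDist_eq]
  refine Real.sqrt_le_iff.2 ⟨by positivity, ?_⟩
  rw [← sq_abs (p.1 - q.1), ← sq_abs (p.2 - q.2)]
  have h3 := pow_le_pow_left₀ (abs_nonneg _) h1 2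
  have h4 := pow_le_pow_left₀ (abs_nonneg _) h2 2
  nlinarith [sq_nonneg (dist p q)]

lemma euclidDist_smul {T : ℝ} (hT : 0 ≤ T) (p q : ℝ × ℝ) :
    euclidDist (T • p) (T • q) = T * euclidDist p q := by
  simp only [euclidDist_eq, Prod.smul_fst, Prod.smul_snd, smul_eq_mul]
  rw [show (T * p.1 - T * q.1) ^ 2 + (T * p.2 - T * q.2) ^ 2
    = T ^ 2 * ((p.1 - q.1) ^ 2 + (p.2 - q.2) ^ 2) by ring, Real.sqrt_mul (sq_nonneg T),
    Real.sqrt_sq hT]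

lemma isCompact_unitSquare : IsCompact unitSquare := isCompact_Icc.prod isCompact_Icc

lemma measurableSet_unitSquare : MeasurableSet unitSquare := isCompact_unitSquare.measurableSet

lemma dist_le_one_of_mem_unitSquare {p q : ℝ × ℝ} (hp : p ∈ unitSquare) (hq : q ∈ unitSquare) :
    dist p q ≤ 1 := by
  obtain ⟨⟨h1, h2⟩, h3, h4⟩ := hp
  obtain ⟨⟨h5, h6⟩, h7, h8⟩ := hq
  rw [Prod.dist_eq, Real.dist_eq, Real.dist_eq]
  refine max_le (abs_le.2 ⟨?_, ?_⟩) (abs_le.2 ⟨?_, ?_⟩) <;> linarith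

/-- A continuous correlation function `c` of the distance, regularly varying with exponent `-α`. -/
structure IsRegularlyVaryingCorrelation (c : ℝ → ℝ) (α : ℝ) (L : ℝ → ℝ) : Prop where
  exponent_pos : 0 < α
  slowlyVarying : SlowlyVarying L
  continuous : Continuous c
  nonneg : ∀ r, 0 ≤ r → 0 ≤ c r
  le_one : ∀ r, c r ≤ 1
  eq_of_pos : ∀ r, 0 < r → c r = r ^ (-α) * L r

namespace IsRegularlyVaryingCorrelation

variable {c L : ℝ → ℝ} {α : ℝ}

lemma continuousOn_slowlyVarying (h : IsRegularlyVaryingCorrelation c α L) :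
    ContinuousOn L (Ioi 0) := by
  have h1 : ContinuousOn (fun r : ℝ => r ^ α * c r) (Ioi 0) :=
    (continuousOn_id.rpow_const fun r hr => Or.inl (ne_of_gt hr)).mul h.continuous.continuousOn
  refine h1.congr fun r hr => ?_
  have hr : 0 < r := hr
  simp only [h.eq_of_pos r hr]
  rw [← mul_assoc, ← Real.rpow_add hr]
  simp

/-- The correlation at distance `T ρ`, in the units `T ^ (-α) * L T` of the correlation at
distance `T`. -/
noncomputable def rescaled (c : ℝ → ℝ) (α : ℝ) (L : ℝ → ℝ) (T ρ : ℝ) : ℝ :=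
  T ^ α * c (T * ρ) / L T

lemma rescaled_eq (h : IsRegularlyVaryingCorrelation c α L) {T ρ : ℝ} (hT : 0 < T) (hρ : 0 < ρ) :
    rescaled c α L T ρ = ρ ^ (-α) * (L (T * ρ) / L T) := by
  rw [rescaled, h.eq_of_pos _ (mul_pos hT hρ), Real.mul_rpow hT.le hρ.le]
  have : T ^ α * T ^ (-α) = 1 := by rw [← Real.rpow_add hT]; simp
  linear_combination (ρ ^ (-α) * L (T * ρ) / L T) * this

lemma rescaled_nonneg (h : IsRegularlyVaryingCorrelation c α L) {T ρ : ℝ} (hT : 0 < T)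
    (hρ : 0 ≤ ρ) : 0 ≤ rescaled c α L T ρ :=
  div_nonneg (mul_nonneg (Real.rpow_nonneg hT.le _) (h.nonneg _ (mul_nonneg hT.le hρ)))
    (h.slowlyVarying.pos T hT).le

lemma tendsto_rescaled (h : IsRegularlyVaryingCorrelation c α L) {ι : Type*} {l : Filter ι}
    {T ρ : ι → ℝ} {a : ℝ} (ha : 0 < a) (hT : Tendsto T l atTop) (hρ : Tendsto ρ l (𝓝 a)) :
    Tendsto (fun i => rescaled c α L (T i) (ρ i)) l (𝓝 (a ^ (-α))) := by
  have h1 := (hρ.rpow_const (p := -α) (Or.inl ha.ne')).mul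
    (h.slowlyVarying.tendsto_div_of_tendsto h.continuousOn_slowlyVarying ha hT hρ)
  rw [mul_one] at h1
  refine h1.congr' ?_
  filter_upwards [hT.eventually_gt_atTop 0, hρ.eventually_const_lt ha] with i h2 h3
  rw [h.rescaled_eq h2 h3]

/-- An integrable majorant for the rescaled correlations, valid at all points `p`, `q` at distance
at most `1 / T` from `u`, `v`. At distances of order `1 / T` the bound `c ≤ 1` is used, at larger
ones Potter's bound. -/
lemma exists_rescaled_le (h : IsRegularlyVaryingCorrelation c α L) {δ : ℝ} (hδ : 0 < δ) :
    ∃ T₀ C, 0 < T₀ ∧ 0 < C ∧ ∀ T, T₀ ≤ T → ∀ u ∈ unitSquare, ∀ v ∈ unitSquare,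
      u.1 ≠ v.1 → u.2 ≠ v.2 → ∀ p ∈ unitSquare, ∀ q ∈ unitSquare,
      dist p u ≤ 1 / T → dist q v ≤ 1 / T →
      rescaled c α L T (euclidDist p q) ≤ C * (|u.1 - v.1| * |u.2 - v.2|) ^ (-((α + δ) / 2)) := by
  obtain ⟨R, C, hR, hC, hP⟩ := h.slowlyVarying.exists_div_le_rpow h.continuousOn_slowlyVarying hδ
    one_le_two
  have hα := h.exponent_pos
  set β := α + δ with hβ
  have hβ0 : 0 < β := by positivity
  -- For `T d ≥ K` the sampled distance `ρ ≥ d - 2 / T` is at least `d / 2`, by `K ≥ 4`, and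
  -- `T ρ ≥ R`, by `K ≥ R + 2`, so that Potter's bound applies.
  set K := max (R + 2) 4 with hK
  have hK0 : 0 < K := by positivity
  have hLR := h.slowlyVarying.pos R hR
  set C₁ := C * R ^ (-δ) / L R * K ^ β with hC₁
  set C₂ := C * (1 / 2) ^ (-β) with hC₂
  have hC₁0 : 0 < C₁ := by positivity
  have hC₂0 : 0 < C₂ := by positivity
  refine ⟨R, max C₁ C₂, hR, by positivity, ?_⟩
  intro T hT u hu v hv h1 h2 p hp q hq hpu hqv
  have hT0 := hR.trans_le hT
  have hLT := h.slowlyVarying.pos T hT0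
  set d := dist u v with hd
  have hd1 : |u.1 - v.1| ≤ d := by rw [hd, Prod.dist_eq, ← Real.dist_eq]; exact le_max_left _ _
  have hd2 : |u.2 - v.2| ≤ d := by rw [hd, Prod.dist_eq, ← Real.dist_eq]; exact le_max_right _ _
  have h1' : 0 < |u.1 - v.1| := abs_pos.2 (sub_ne_zero.2 h1)
  have h2' : 0 < |u.2 - v.2| := abs_pos.2 (sub_ne_zero.2 h2)
  have hd0 : 0 < d := h1'.trans_le hd1
  -- the maximum of the two coordinate distances is at least their geometric mean
  have hprod : d ^ (-β) ≤ (|u.1 - v.1| * |u.2 - v.2|) ^ (-(β / 2)) := by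
    calc d ^ (-β) = (d * d) ^ (-(β / 2)) := by
          rw [Real.mul_rpow hd0.le hd0.le, ← Real.rpow_add hd0]; congr 1; ring
      _ ≤ _ := Real.rpow_le_rpow_of_nonpos (by positivity) (by gcongr) (by linarith)
  suffices hs : rescaled c α L T (euclidDist p q) ≤ max C₁ C₂ * d ^ (-β) from
    hs.trans (by gcongr)
  have hTd : T * dist p q ≥ T * d - 2 := by
    have h3 : d ≤ dist p u + dist p q + dist q v := by
      rw [hd, dist_comm p u]; exact dist_triangle4 u p q v
    have h4 : dist p q ≥ d - 2 * (1 / T) := by linarith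
    calc T * dist p q ≥ T * (d - 2 * (1 / T)) := by gcongr
      _ = T * d - 2 := by field_simp
  have hρ1 := dist_le_euclidDist p q
  have hρ2 : euclidDist p q ≤ 2 :=
    (euclidDist_le_two_mul_dist p q).trans (by linarith [dist_le_one_of_mem_unitSquare hp hq])
  set ρ := euclidDist p q
  have hTρ : T * d - 2 ≤ T * ρ := hTd.le.trans (by gcongr)
  rcases le_or_gt K (T * d) with hcase | hcase
  · have h4 : R + 2 ≤ T * d := (le_max_left _ _).trans hcase
    have h5 : 4 ≤ T * d := (le_max_right _ _).trans hcase
    have hρd : 1 / 2 * d ≤ ρ := by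
      have : T * (1 / 2 * d) ≤ T * ρ := by linarith
      exact le_of_mul_le_mul_left this hT0
    have hρ0 : 0 < ρ := lt_of_lt_of_le (by positivity) hρd
    have hpot := hP (T * ρ) T (by linarith) hT (by nlinarith)
    rw [h.rescaled_eq hT0 hρ0]
    have e : T / (T * ρ) = ρ⁻¹ := by field_simp
    rw [e, Real.inv_rpow hρ0.le, ← Real.rpow_neg hρ0.le] at hpot
    calc ρ ^ (-α) * (L (T * ρ) / L T) ≤ ρ ^ (-α) * (C * ρ ^ (-δ)) := by gcongr
      _ = C * ρ ^ (-β) := by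
          rw [hβ, neg_add, Real.rpow_add hρ0]; ring
      _ ≤ C * (1 / 2 * d) ^ (-β) := by
          gcongr C * ?_
          exact Real.rpow_le_rpow_of_nonpos (by positivity) hρd (by linarith)
      _ = C₂ * d ^ (-β) := by rw [Real.mul_rpow (by norm_num) hd0.le, hC₂]; ring
      _ ≤ _ := by gcongr; exact le_max_right _ _
  · have hpot := hP R T le_rfl hT (by linarith)
    have hTK : T ≤ K / d := by rw [le_div_iff₀ hd0]; exact hcase.le
    calc rescaled c α L T ρ ≤ T ^ α * 1 / L T := by
          unfold rescaled; gcongr; exact h.le_one _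
      _ = T ^ α * (L R / L T) / L R := by field_simp
      _ ≤ T ^ α * (C * (T / R) ^ δ) / L R := by gcongr
      _ = C * R ^ (-δ) / L R * T ^ β := by
          rw [Real.div_rpow hT0.le hR.le, hβ, Real.rpow_add hT0, Real.rpow_neg hR.le]; ring
      _ ≤ C * R ^ (-δ) / L R * (K / d) ^ β := by gcongr
      _ = C₁ * d ^ (-β) := by
          rw [Real.div_rpow hK0.le hd0.le, Real.rpow_neg hd0.le, hC₁]; ring
      _ ≤ _ := by gcongr; exact le_max_left _ _

end IsRegularlyVaryingCorrelation

lemma integrableOn_abs_rpow {κ : ℝ} (hκ : κ < 1) :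
    IntegrableOn (fun t : ℝ => |t| ^ (-κ)) (Icc (-1) 1) := by
  have h0 : IntervalIntegrable (fun t : ℝ => |t| ^ (-κ)) volume 0 1 := by
    refine (intervalIntegral.intervalIntegrable_rpow' (r := -κ) (by linarith)).congr ?_
    intro t ht
    rw [uIoc_of_le zero_le_one] at ht
    simp only [abs_of_pos ht.1]
  have h1 : IntervalIntegrable (fun t : ℝ => |t| ^ (-κ)) volume 0 (-1) := by
    have := (IntervalIntegrable.iff_comp_neg (by simp)).1 h0
    simpa using this
  rw [← intervalIntegrable_iff_integrableOn_Icc_of_le (by norm_num) (by simp)]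
  exact h1.symm.trans h0

/-- The majorant of the rescaled covariance kernel is integrable. It is bounded by the integrand of
the convolution of the indicator of the unit square with an integrable function. -/
lemma integrableOn_abs_sub_mul_abs_sub_rpow {κ : ℝ} (hκ : κ < 1) :
    IntegrableOn (fun z : (ℝ × ℝ) × (ℝ × ℝ) => (|z.1.1 - z.2.1| * |z.1.2 - z.2.2|) ^ (-κ))
      (unitSquare ×ˢ unitSquare) := by
  have hm := measurableSet_unitSquare
  have h1 : Integrable (fun t : ℝ => (Icc (-1 : ℝ) 1).indicator (fun t => |t| ^ (-κ)) t) := by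
    rw [integrable_indicator_iff measurableSet_Icc]
    exact integrableOn_abs_rpow hκ
  have h2 : Integrable (fun t : ℝ × ℝ => unitSquare.indicator (fun _ => (1 : ℝ)) t) := by
    rw [integrable_indicator_iff hm]
    exact integrableOn_const isCompact_unitSquare.measure_lt_top.ne
  have h3 := h2.convolution_integrand (ContinuousLinearMap.mul ℝ ℝ) (h1.mul_prod h1)
  rw [← Measure.volume_eq_prod, ← Measure.volume_eq_prod] at h3
  refine (h3.integrableOn (s := unitSquare ×ˢ unitSquare)).congr_fun (fun z hz => ?_) (hm.prod hm)
  obtain ⟨hz1, hz2⟩ := hz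
  have hz2' := hz2
  obtain ⟨⟨h4, h5⟩, h6, h7⟩ := hz1
  obtain ⟨⟨h8, h9⟩, h10, h11⟩ := hz2'
  simp only [ContinuousLinearMap.mul_apply', indicator_of_mem hz2, one_mul, Prod.fst_sub,
    Prod.snd_sub]
  have e1 : z.1.1 - z.2.1 ∈ Icc (-1 : ℝ) 1 := ⟨by linarith, by linarith⟩
  have e2 : z.1.2 - z.2.2 ∈ Icc (-1 : ℝ) 1 := ⟨by linarith, by linarith⟩
  rw [indicator_of_mem e1, indicator_of_mem e2, Real.mul_rpow (abs_nonneg _) (abs_nonneg _)]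

/-! ### Limits of quadratic forms in the rescaled covariance kernel -/

/-- Weights `w i` on the unit square and points `p i u` at which the field is sampled in place of
`u`, such that the points are within `1 / T i` of `u` and the weights tend to `φ` boundedly and
almost everywhere. -/
structure IsAsymptoticSampling {ι : Type*} (l : Filter ι) (T : ι → ℝ) (w : ι → ℝ × ℝ → ℝ)
    (p : ι → ℝ × ℝ → ℝ × ℝ) (φ : ℝ × ℝ → ℝ) : Prop where
  measurable_weight : ∀ i, Measurable (w i)
  measurable_point : ∀ i, Measurable (p i)
  bounded : ∃ M : ℝ, ∀ᶠ i in l, ∀ u ∈ unitSquare, |w i u| ≤ M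
  point_mem : ∀ᶠ i in l, ∀ u ∈ unitSquare, p i u ∈ unitSquare ∧ dist (p i u) u ≤ 1 / T i
  tendsto : ∀ᵐ u ∂((volume : Measure (ℝ × ℝ)).restrict unitSquare),
    Tendsto (fun i => w i u) l (𝓝 (φ u))

lemma ae_fst_ne_and_snd_ne (a : ℝ × ℝ) : ∀ᵐ u : ℝ × ℝ, u.1 ≠ a.1 ∧ u.2 ≠ a.2 := by
  have h : ∀ x : ℝ, ∀ᵐ y : ℝ, y ≠ x := fun x => by simp [ae_iff]
  rw [Measure.volume_eq_prod]
  filter_upwards [Measure.quasiMeasurePreserving_fst.ae (h a.1),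
    Measure.quasiMeasurePreserving_snd.ae (h a.2)] with u h1 h2
  exact ⟨h1, h2⟩

lemma ae_prod_fst_ne_and_snd_ne :
    ∀ᵐ z : (ℝ × ℝ) × (ℝ × ℝ), z.1.1 ≠ z.2.1 ∧ z.1.2 ≠ z.2.2 := by
  have hm : MeasurableSet {z : (ℝ × ℝ) × (ℝ × ℝ) | z.1.1 ≠ z.2.1 ∧ z.1.2 ≠ z.2.2} := by
    refine IsOpen.measurableSet (IsOpen.and ?_ ?_)
    · exact isOpen_ne_fun (by fun_prop) (by fun_prop)
    · exact isOpen_ne_fun (by fun_prop) (by fun_prop)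
  rw [Measure.volume_eq_prod]
  refine (Measure.ae_prod_mem_iff_ae_ae_mem hm).2 (ae_of_all _ fun u => ?_)
  filter_upwards [ae_fst_ne_and_snd_ne u] with v hv
  exact ⟨hv.1.symm, hv.2.symm⟩

open IsRegularlyVaryingCorrelation in
/-- Quadratic forms in the `m`-th power of the rescaled correlation have a limit which depends on
the sampling scheme only through the limit of the weights. -/
lemma IsAsymptoticSampling.tendsto_integral {ι : Type*} {l : Filter ι} [l.IsCountablyGenerated]
    {T : ι → ℝ} {w₁ w₂ : ι → ℝ × ℝ → ℝ} {p₁ p₂ : ι → ℝ × ℝ → ℝ × ℝ} {φ : ℝ × ℝ → ℝ}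
    (h₁ : IsAsymptoticSampling l T w₁ p₁ φ) (h₂ : IsAsymptoticSampling l T w₂ p₂ φ)
    (hT : Tendsto T l atTop) {c L : ℝ → ℝ} {α : ℝ} (hc : IsRegularlyVaryingCorrelation c α L)
    {m : ℕ} (hm : 1 ≤ m) (hα : α < 2 / (m : ℝ)) :
    Tendsto (fun i => ∫ z in unitSquare ×ˢ unitSquare,
        w₁ i z.1 * w₂ i z.2 * rescaled c α L (T i) (euclidDist (p₁ i z.1) (p₂ i z.2)) ^ m) l
      (𝓝 (∫ z in unitSquare ×ˢ unitSquare,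
        φ z.1 * φ z.2 * (euclidDist z.1 z.2 ^ (-α)) ^ m)) := by
  have hm0 : (0 : ℝ) < m := by exact_mod_cast hm
  set δ := (2 / (m : ℝ) - α) / 2 with hδ
  have hδ0 : 0 < δ := by linarith
  set κ := (α + δ) / 2 * m with hκ
  have hκ1 : κ < 1 := by
    have : (α + δ) / 2 < 1 / m := by
      have : (2 : ℝ) / m = 2 * (1 / m) := by ring
      linarith
    calc κ < 1 / m * m := by rw [hκ]; gcongr
      _ = 1 := by field_simp
  obtain ⟨T₀, C, hT₀, hC, hbound⟩ := hc.exists_rescaled_le hδ0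
  obtain ⟨M₁, hM₁⟩ := h₁.bounded
  obtain ⟨M₂, hM₂⟩ := h₂.bounded
  have hsq := measurableSet_unitSquare
  have hne : ∀ᵐ z ∂((volume : Measure ((ℝ × ℝ) × (ℝ × ℝ))).restrict (unitSquare ×ˢ unitSquare)),
      z.1.1 ≠ z.2.1 ∧ z.1.2 ≠ z.2.2 := ae_restrict_of_ae ae_prod_fst_ne_and_snd_ne
  have hmem := ae_restrict_mem (μ := (volume : Measure ((ℝ × ℝ) × (ℝ × ℝ)))) (hsq.prod hsq)
  refine tendsto_integral_filter_of_dominated_convergence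
    (fun z => M₁ * M₂ * C ^ m * (|z.1.1 - z.2.1| * |z.1.2 - z.2.2|) ^ (-κ)) ?_ ?_ ?_ ?_
  · refine Eventually.of_forall fun i => Measurable.aestronglyMeasurable ?_
    have m1 := (h₁.measurable_weight i).comp
      (measurable_fst : Measurable (Prod.fst : (ℝ × ℝ) × (ℝ × ℝ) → _))
    have m2 := (h₂.measurable_weight i).comp
      (measurable_snd : Measurable (Prod.snd : (ℝ × ℝ) × (ℝ × ℝ) → _))
    have m3 := continuous_euclidDist.measurable.comp
      (((h₁.measurable_point i).comp measurable_fst).prodMk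
        ((h₂.measurable_point i).comp measurable_snd))
    have m4 : Measurable (rescaled c α L (T i)) := by
      unfold rescaled
      exact ((hc.continuous.comp (by fun_prop)).measurable.const_mul _).div_const _
    exact (m1.mul m2).mul ((m4.comp m3).pow_const m)
  · filter_upwards [hM₁, hM₂, h₁.point_mem, h₂.point_mem, hT.eventually_ge_atTop T₀]
      with i b1 b2 q1 q2 hTi
    filter_upwards [hne, hmem] with z hz hzm
    have hr := hbound (T i) hTi z.1 hzm.1 z.2 hzm.2 hz.1 hz.2 _ (q1 z.1 hzm.1).1 _
      (q2 z.2 hzm.2).1 (q1 z.1 hzm.1).2 (q2 z.2 hzm.2).2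
    have hr0 := hc.rescaled_nonneg (hT₀.trans_le hTi)
      (euclidDist_nonneg (p₁ i z.1) (p₂ i z.2))
    have c1 := b1 z.1 hzm.1
    have c2 := b2 z.2 hzm.2
    have hM1 := (abs_nonneg _).trans c1
    have hM2 := (abs_nonneg _).trans c2
    rw [Real.norm_eq_abs, abs_mul, abs_mul, abs_of_nonneg (pow_nonneg hr0 m)]
    calc _ ≤ M₁ * M₂ * (C * (|z.1.1 - z.2.1| * |z.1.2 - z.2.2|) ^ (-((α + δ) / 2))) ^ m := by
          gcongr
      _ = _ := by
          rw [mul_pow, ← Real.rpow_mul_natCast (by positivity), neg_mul, ← mul_assoc]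
  · exact (integrableOn_abs_sub_mul_abs_sub_rpow hκ1).const_mul _
  · have hpr : (volume : Measure ((ℝ × ℝ) × (ℝ × ℝ))).restrict (unitSquare ×ˢ unitSquare)
        = (volume.restrict unitSquare).prod (volume.restrict unitSquare) := by
      rw [Measure.prod_restrict, ← Measure.volume_eq_prod]
    have l1 := Measure.quasiMeasurePreserving_fst
      (μ := (volume : Measure (ℝ × ℝ)).restrict unitSquare)
      (ν := (volume : Measure (ℝ × ℝ)).restrict unitSquare) |>.ae h₁.tendsto
    have l2 := Measure.quasiMeasurePreserving_snd
      (μ := (volume : Measure (ℝ × ℝ)).restrict unitSquare)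
      (ν := (volume : Measure (ℝ × ℝ)).restrict unitSquare) |>.ae h₂.tendsto
    rw [← hpr] at l1 l2
    have hpt : ∀ {p : ι → ℝ × ℝ → ℝ × ℝ}, (∀ᶠ i in l, ∀ u ∈ unitSquare,
        p i u ∈ unitSquare ∧ dist (p i u) u ≤ 1 / T i) → ∀ u ∈ unitSquare,
        Tendsto (fun i => p i u) l (𝓝 u) := by
      intro p hp u hu
      rw [tendsto_iff_dist_tendsto_zero]
      refine squeeze_zero' (Eventually.of_forall fun i => dist_nonneg)
        (hp.mono fun i hi => (hi u hu).2) ?_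
      simp only [one_div]
      exact hT.inv_tendsto_atTop
    filter_upwards [l1, l2, hne, hmem] with z t1 t2 hz hzm
    have hd : 0 < euclidDist z.1 z.2 := by
      refine lt_of_lt_of_le (dist_pos.2 fun h => hz.1 (by rw [h])) (dist_le_euclidDist _ _)
    have te : Tendsto (fun i => euclidDist (p₁ i z.1) (p₂ i z.2)) l (𝓝 (euclidDist z.1 z.2)) :=
      ((continuous_planePoint.tendsto z.1).comp (hpt h₁.point_mem z.1 hzm.1)).dist
        ((continuous_planePoint.tendsto z.2).comp (hpt h₂.point_mem z.2 hzm.2))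
    exact (t1.mul t2).mul ((hc.tendsto_rescaled hd hT te).pow m)

/-- A map sending each point of the closed quadrant to a point of the quadrant which is at most one
unit to the left and one unit below. -/
structure IsSampling (π : ℝ × ℝ → ℝ × ℝ) : Prop where
  measurable : Measurable π
  nonneg : ∀ t, 0 ≤ t → 0 ≤ π t
  le_self : ∀ t, 0 ≤ t → π t ≤ t
  self_le : ∀ t, 0 ≤ t → t ≤ π t + 1

/-- The lower left corner of the unit lattice cell containing a point of the quadrant. -/
noncomputable def cellCorner (t : ℝ × ℝ) : ℝ × ℝ := (⌊t.1⌋₊, ⌊t.2⌋₊)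

lemma isSampling_id : IsSampling id where
  measurable := measurable_id
  nonneg _ h := h
  le_self _ _ := le_rfl
  self_le t _ := by simp

lemma isSampling_cellCorner : IsSampling cellCorner where
  measurable := by
    unfold cellCorner
    have : Measurable (fun x : ℝ => ((⌊x⌋₊ : ℕ) : ℝ)) := by fun_prop
    exact (this.comp measurable_fst).prodMk (this.comp measurable_snd)
  nonneg t _ := ⟨Nat.cast_nonneg _, Nat.cast_nonneg _⟩
  le_self t h := ⟨Nat.floor_le h.1, Nat.floor_le h.2⟩
  self_le t _ := ⟨(Nat.lt_floor_add_one t.1).le, (Nat.lt_floor_add_one t.2).le⟩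

/-- The weight of `t ∈ S`, which is the value of `g` at the sampled point `π t`; zero outside `S`. -/
noncomputable def sampledWeight (g : ℝ → ℝ → ℝ) (S : Set (ℝ × ℝ)) (π : ℝ × ℝ → ℝ × ℝ) :
    ℝ × ℝ → ℝ :=
  S.indicator fun t => g (π t).1 (π t).2

lemma mem_unitSquare_iff {u : ℝ × ℝ} : u ∈ unitSquare ↔ 0 ≤ u ∧ u ≤ 1 := by
  simp only [unitSquare, mem_prod, mem_Icc, Prod.le_def, Prod.fst_zero, Prod.snd_zero,
    Prod.fst_one, Prod.snd_one]
  tauto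

lemma IsSampling.rescaled_mem {π : ℝ × ℝ → ℝ × ℝ} (hπ : IsSampling π) {T : ℝ} (hT : 0 < T)
    {u : ℝ × ℝ} (hu : u ∈ unitSquare) :
    T⁻¹ • π (T • u) ∈ unitSquare ∧ dist (T⁻¹ • π (T • u)) u ≤ 1 / T := by
  have hu' := mem_unitSquare_iff.1 hu
  have h0 : 0 ≤ T • u := smul_nonneg hT.le hu'.1
  obtain ⟨h1, h2⟩ := hπ.nonneg _ h0
  obtain ⟨h3, h4⟩ := hπ.le_self _ h0
  obtain ⟨h5, h6⟩ := hπ.self_le _ h0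
  simp only [Prod.fst_zero, Prod.snd_zero, Prod.smul_fst, Prod.smul_snd, smul_eq_mul,
    Prod.fst_add, Prod.snd_add, Prod.fst_one, Prod.snd_one] at h1 h2 h3 h4 h5 h6
  have k : ∀ a b : ℝ, a ≤ T * b → T⁻¹ * a ≤ b := fun a b h => by
    rw [inv_mul_le_iff₀ hT]; exact h
  have k' : ∀ a b : ℝ, T * b ≤ a + 1 → b - T⁻¹ * a ≤ 1 / T := fun a b h => by
    rw [le_div_iff₀ hT]; field_simp; linarith
  have hi := inv_pos.2 hT
  refine ⟨mem_unitSquare_iff.2 ⟨⟨mul_nonneg hi.le h1, mul_nonneg hi.le h2⟩,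
    (k _ _ h3).trans hu'.2.1, (k _ _ h4).trans hu'.2.2⟩, ?_⟩
  rw [Prod.dist_eq, Real.dist_eq, Real.dist_eq, abs_sub_comm, abs_sub_comm _ u.2]
  simp only [Prod.smul_fst, Prod.smul_snd, smul_eq_mul]
  rw [abs_of_nonneg (by linarith [k _ _ h3]), abs_of_nonneg (by linarith [k _ _ h4])]
  exact max_le (k' _ _ h5) (k' _ _ h6)

section Weight

variable {m : ℕ} {α : ℝ} {L : ℝ → ℝ} {g gstar : ℝ → ℝ → ℝ}

lemma measurable_sampledWeight (hg : IsAdmissibleWeight m α L g gstar) {S : Set (ℝ × ℝ)}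
    (hS : MeasurableSet S) {π : ℝ × ℝ → ℝ × ℝ} (hπ : IsSampling π) :
    Measurable (sampledWeight g S π) :=
  (hg.measurable.comp hπ.measurable).indicator hS

/-- The weight is eventually nonzero on the diagonal, since the normalization diverges. -/
lemma IsAdmissibleWeight.eventually_ne_zero (hg : IsAdmissibleWeight m α L g gstar) :
    ∀ᶠ T in atTop, g T T ≠ 0 := by
  filter_upwards [hg.nondegenerate.eventually_gt_atTop 0] with T hT h
  simp [h] at hT

lemma IsAdmissibleWeight.exists_abs_div_le (hg : IsAdmissibleWeight m α L g gstar) :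
    ∃ M : ℝ, ∀ᶠ T in atTop, ∀ p ∈ unitSquare, |g (T * p.1) (T * p.2) / g T T| ≤ M := by
  obtain ⟨C, hC⟩ := hg.limit_bounded
  refine ⟨C + 1, ?_⟩
  filter_upwards [Metric.tendstoUniformlyOn_iff.1 hg.tendsto_uniformly 1 one_pos] with T hT p hp
  have h1 := hT p hp
  rw [Real.dist_eq] at h1
  have h2 := hC p hp
  have h3 := abs_sub_abs_le_abs_sub (g (T * p.1) (T * p.2) / g T T) (gstar p.1 p.2)
  rw [abs_sub_comm] at h1
  linarith

/-- An admissible weight is bounded on bounded subsets of the quadrant. -/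
lemma IsAdmissibleWeight.exists_abs_le (hg : IsAdmissibleWeight m α L g gstar) (T : ℝ) :
    ∃ M : ℝ, ∀ t : ℝ × ℝ, 0 ≤ t → t ≤ (T, T) → |g t.1 t.2| ≤ M := by
  obtain ⟨M, hM⟩ := hg.exists_abs_div_le
  obtain ⟨R, h1, h2, h3, h4⟩ := (hM.and (hg.eventually_ne_zero.and
    ((eventually_ge_atTop T).and (eventually_gt_atTop 0)))).exists
  refine ⟨M * |g R R|, fun t ht htT => ?_⟩
  have hi := inv_pos.2 h4
  have k : ∀ a : ℝ, a ≤ T → R⁻¹ * a ≤ 1 := fun a h => by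
    rw [inv_mul_le_iff₀ h4, mul_one]; exact h.trans h3
  have h5 := h1 (R⁻¹ • t) (mem_unitSquare_iff.2 ⟨smul_nonneg hi.le ht, k _ htT.1, k _ htT.2⟩)
  simp only [Prod.smul_fst, Prod.smul_snd, smul_eq_mul, mul_inv_cancel_left₀ h4.ne'] at h5
  rwa [abs_div, div_le_iff₀ (abs_pos.2 h2)] at h5

/-- The rescaled weights of a sampling scheme form an asymptotic sampling with limit `g*`. The
points of discontinuity of `g*` form a null set, and at all others uniform convergence gives
convergence along the moving sampled points. -/
lemma IsAdmissibleWeight.isAsymptoticSampling (hg : IsAdmissibleWeight m α L g gstar)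
    {ι : Type*} {l : Filter ι} {T : ι → ℝ} (hT : Tendsto T l atTop) {π : ℝ × ℝ → ℝ × ℝ}
    (hπ : IsSampling π) {S : ι → Set (ℝ × ℝ)} (hS : ∀ i, MeasurableSet (S i)) {A : Set (ℝ × ℝ)}
    (hA : ∀ᵐ u ∂((volume : Measure (ℝ × ℝ)).restrict unitSquare),
      ∀ᶠ i in l, (T i • u ∈ S i ↔ u ∈ A)) :
    IsAsymptoticSampling l T
      (fun i u => sampledWeight g (S i) π (T i • u) / g (T i) (T i))
      (fun i u => (T i)⁻¹ • π (T i • u)) (A.indicator fun u => gstar u.1 u.2) where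
  measurable_weight i :=
    ((measurable_sampledWeight hg (hS i) hπ).comp (measurable_const_smul (T i))).div_const _
  measurable_point i := (measurable_const_smul (T i)⁻¹).comp
    (hπ.measurable.comp (measurable_const_smul (T i)))
  point_mem := (hT.eventually_gt_atTop 0).mono fun i hi u hu => hπ.rescaled_mem hi hu
  bounded := by
    obtain ⟨M, hM⟩ := hg.exists_abs_div_le
    refine ⟨M, ?_⟩
    filter_upwards [hT.eventually hM, hT.eventually_gt_atTop 0] with i h1 h2 u hu
    have h3 := h1 _ (hπ.rescaled_mem h2 hu).1
    simp only [Prod.smul_fst, Prod.smul_snd, smul_eq_mul, mul_inv_cancel_left₀ h2.ne'] at h3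
    by_cases h : T i • u ∈ S i
    · rw [sampledWeight, indicator_of_mem h]; exact h3
    · rw [sampledWeight, indicator_of_notMem h]
      simpa using (abs_nonneg _).trans h3
  tendsto := by
    filter_upwards [hA, hg.limit_ae_continuous, ae_restrict_mem measurableSet_unitSquare]
      with u h1 h2 hu
    have hpos := hT.eventually_gt_atTop 0
    have hp : Tendsto (fun i => (T i)⁻¹ • π (T i • u)) l (𝓝[unitSquare] u) := by
      refine tendsto_nhdsWithin_iff.2 ⟨?_, hpos.mono fun i hi => (hπ.rescaled_mem hi hu).1⟩
      rw [tendsto_iff_dist_tendsto_zero]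
      refine squeeze_zero' (Eventually.of_forall fun i => dist_nonneg)
        (hpos.mono fun i hi => (hπ.rescaled_mem hi hu).2) ?_
      simp only [one_div]
      exact hT.inv_tendsto_atTop
    have hU : TendstoUniformlyOn
        (fun (i : ι) (p : ℝ × ℝ) => g (T i * p.1) (T i * p.2) / g (T i) (T i))
        (fun p : ℝ × ℝ => gstar p.1 p.2) l unitSquare :=
      fun V hV => hT.eventually (hg.tendsto_uniformly V hV)
    have h3 := hU.tendsto_comp h2 hp
    by_cases hu : u ∈ A
    · rw [indicator_of_mem hu]
      refine h3.congr' ?_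
      filter_upwards [h1, hpos] with i h4 h5
      simp only [Prod.smul_fst, Prod.smul_snd, smul_eq_mul, mul_inv_cancel_left₀ h5.ne']
      rw [sampledWeight, indicator_of_mem (h4.2 hu)]
    · rw [indicator_of_notMem hu]
      refine tendsto_const_nhds.congr' ?_
      filter_upwards [h1] with i h4
      rw [sampledWeight, indicator_of_notMem fun h => hu (h4.1 h), zero_div]

end Weight

/-! ### Second moments of integrals of random functions -/

section Bilinear

variable {T Ω : Type*} [MeasurableSpace T] [MeasurableSpace Ω] {μ : Measure T} [IsFiniteMeasure μ]
  {P : Measure Ω} [IsProbabilityMeasure P] {F G : T → Ω → ℝ}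

/-- The product of two random functions with bounded second moments, as a function of two
parameters and the random outcome, is integrable. -/
lemma integrable_mul_of_bounded_second_moment
    (hF : Measurable (Function.uncurry F)) (hG : Measurable (Function.uncurry G))
    (hF2 : ∀ t, MemLp (F t) 2 P) (hG2 : ∀ t, MemLp (G t) 2 P) {K : ℝ}
    (hFK : ∀ t, ∫ ω, F t ω ^ 2 ∂P ≤ K) (hGK : ∀ t, ∫ ω, G t ω ^ 2 ∂P ≤ K) :
    Integrable (fun q : (T × T) × Ω => F q.1.1 q.2 * G q.1.2 q.2) ((μ.prod μ).prod P) := by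
  have hm : Measurable (fun q : (T × T) × Ω => F q.1.1 q.2 * G q.1.2 q.2) :=
    (hF.comp ((measurable_fst.comp measurable_fst).prodMk measurable_snd)).mul
      (hG.comp ((measurable_snd.comp measurable_fst).prodMk measurable_snd))
  rw [integrable_prod_iff hm.aestronglyMeasurable]
  refine ⟨ae_of_all _ fun z => (hF2 z.1).integrable_mul (hG2 z.2), ?_⟩
  refine Integrable.of_bound (C := K)
    hm.norm.stronglyMeasurable.integral_prod_right'.aestronglyMeasurable (ae_of_all _ fun z => ?_)
  have i1 := (hF2 z.1).integrable_sq
  have i2 := (hG2 z.2).integrable_sq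
  rw [Real.norm_eq_abs, abs_of_nonneg (integral_nonneg fun _ => norm_nonneg _)]
  calc ∫ ω, ‖F z.1 ω * G z.2 ω‖ ∂P ≤ ∫ ω, (F z.1 ω ^ 2 + G z.2 ω ^ 2) / 2 ∂P := by
        refine integral_mono ((hF2 z.1).integrable_mul (hG2 z.2)).norm
          ((i1.add i2).div_const 2) fun ω => ?_
        simp only [Real.norm_eq_abs, abs_mul]
        nlinarith [sq_nonneg (|F z.1 ω| - |G z.2 ω|), sq_abs (F z.1 ω), sq_abs (G z.2 ω)]
    _ = ((∫ ω, F z.1 ω ^ 2 ∂P) + ∫ ω, G z.2 ω ^ 2 ∂P) / 2 := by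
        rw [integral_div, integral_add i1 i2]
    _ ≤ K := by linarith [hFK z.1, hGK z.2]

lemma memLp_two_integral
    (hF : Measurable (Function.uncurry F)) (hF2 : ∀ t, MemLp (F t) 2 P) {K : ℝ}
    (hFK : ∀ t, ∫ ω, F t ω ^ 2 ∂P ≤ K) : MemLp (fun ω => ∫ t, F t ω ∂μ) 2 P := by
  have hm : StronglyMeasurable (fun ω => ∫ t, F t ω ∂μ) := by
    have := (hF.comp measurable_swap).stronglyMeasurable.integral_prod_right' (ν := μ)
    exact this
  rw [memLp_two_iff_integrable_sq hm.aestronglyMeasurable]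
  have h := (integrable_mul_of_bounded_second_moment (μ := μ) hF hF hF2 hF2 hFK
    hFK).integral_prod_right
  refine h.congr (ae_of_all _ fun ω => ?_)
  simp only
  rw [integral_prod_mul (fun t => F t ω) (fun t => F t ω), pow_two]

/-- The expected product of two integrals is the double integral of the expected product. -/
lemma integral_integral_mul_integral
    (hF : Measurable (Function.uncurry F)) (hG : Measurable (Function.uncurry G))
    (hF2 : ∀ t, MemLp (F t) 2 P) (hG2 : ∀ t, MemLp (G t) 2 P) {K : ℝ}
    (hFK : ∀ t, ∫ ω, F t ω ^ 2 ∂P ≤ K) (hGK : ∀ t, ∫ ω, G t ω ^ 2 ∂P ≤ K) :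
    ∫ ω, (∫ t, F t ω ∂μ) * (∫ t, G t ω ∂μ) ∂P
      = ∫ z, (∫ ω, F z.1 ω * G z.2 ω ∂P) ∂(μ.prod μ) := by
  have h := integrable_mul_of_bounded_second_moment (μ := μ) hF hG hF2 hG2 hFK hGK
  rw [integral_integral_swap (f := fun (z : T × T) ω => F z.1 ω * G z.2 ω) h]
  congr 1 with ω
  rw [integral_prod_mul (fun t => F t ω) (fun t => G t ω)]

/-- Almost every path of a random function with bounded second moments is integrable. -/
lemma ae_integrable_of_bounded_second_moment
    (hF : Measurable (Function.uncurry F)) (hF2 : ∀ t, MemLp (F t) 2 P) {K : ℝ}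
    (hFK : ∀ t, ∫ ω, F t ω ^ 2 ∂P ≤ K) : ∀ᵐ ω ∂P, Integrable (fun t => F t ω) μ := by
  have h : Integrable (Function.uncurry F) (μ.prod P) := by
    rw [integrable_prod_iff hF.aestronglyMeasurable]
    refine ⟨ae_of_all _ fun t => (hF2 t).integrable one_le_two, ?_⟩
    refine Integrable.of_bound (C := (1 + K) / 2)
      hF.norm.stronglyMeasurable.integral_prod_right'.aestronglyMeasurable
      (ae_of_all _ fun t => ?_)
    rw [Real.norm_eq_abs, abs_of_nonneg (integral_nonneg fun _ => norm_nonneg _)]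
    have i1 := (hF2 t).integrable_sq
    calc ∫ ω, ‖F t ω‖ ∂P ≤ ∫ ω, (1 + F t ω ^ 2) / 2 ∂P := by
          refine integral_mono ((hF2 t).integrable one_le_two).norm
            (((integrable_const 1).add i1).div_const 2) fun ω => ?_
          simp only [Real.norm_eq_abs]
          nlinarith [sq_nonneg (|F t ω| - 1), sq_abs (F t ω)]
      _ = (1 + ∫ ω, F t ω ^ 2 ∂P) / 2 := by
          rw [integral_div, integral_add (integrable_const 1) i1]; simp
      _ ≤ (1 + K) / 2 := by linarith [hFK t]
  exact h.prod_left_ae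

end Bilinear

/-- The Cauchy–Schwarz inequality, for a first factor of norm one. -/
lemma sq_integral_mul_le {Ω : Type*} [MeasurableSpace Ω] {P : Measure Ω} {a b : Ω → ℝ}
    (ha : MemLp a 2 P) (hb : MemLp b 2 P)
    (h1 : ∫ ω, a ω * a ω ∂P = 1) : (∫ ω, a ω * b ω ∂P) ^ 2 ≤ ∫ ω, b ω ^ 2 ∂P := by
  -- expand the second moment of `b` minus its projection `x a` on `a`
  set x := ∫ ω, a ω * b ω ∂P with hx
  have iab : Integrable (fun ω => a ω * b ω) P := ha.integrable_mul hb
  have iaa : Integrable (fun ω => a ω * a ω) P := ha.integrable_mul ha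
  have h : 0 ≤ ∫ ω, (b ω ^ 2 - 2 * x * (a ω * b ω)) + x ^ 2 * (a ω * a ω) ∂P :=
    integral_nonneg fun ω => by
      have : (b ω ^ 2 - 2 * x * (a ω * b ω)) + x ^ 2 * (a ω * a ω) = (b ω - x * a ω) ^ 2 := by ring
      simp only [this]
      exact sq_nonneg _
  have i3 : Integrable (fun ω => b ω ^ 2 - 2 * x * (a ω * b ω)) P :=
    hb.integrable_sq.sub (iab.const_mul _)
  rw [integral_add i3 (iaa.const_mul _), integral_sub hb.integrable_sq (iab.const_mul _),
    integral_const_mul, integral_const_mul, h1,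
    ← hx] at h
  linarith

/-! ### The covariance of the field and of its Hermite functionals -/

section Field

variable {Ω : Type*} [MeasurableSpace Ω] {P : Measure Ω}
  {ξ : Plane → Ω → ℝ} {α : ℝ} {L : ℝ → ℝ}

/-- The covariance of an isotropic field as a function of the distance. -/
noncomputable def radialCovariance (ξ : Plane → Ω → ℝ) (P : Measure Ω) (r : ℝ) : ℝ :=
  ∫ ω, ξ 0 ω * ξ (planePoint (r, 0)) ω ∂P

lemma dist_zero_planePoint (r : ℝ) : dist 0 (planePoint (r, 0)) = |r| := by
  have h : (0 : Plane) = planePoint (0, 0) := by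
    ext i; fin_cases i <;> simp [planePoint]
  have := euclidDist_eq (0, 0) (r, 0)
  rw [euclidDist, ← h] at this
  rw [this]
  simp [Real.sqrt_sq_eq_abs]

lemma IsHomogeneousIsotropicGaussianField.integral_mul_eq
    (hξ : IsHomogeneousIsotropicGaussianField ξ P) (x y : Plane) :
    ∫ ω, ξ x ω * ξ y ω ∂P = radialCovariance ξ P (dist x y) :=
  hξ.homogeneous_isotropic _ _ _ _ (by rw [dist_zero_planePoint, abs_of_nonneg dist_nonneg])

lemma IsHomogeneousIsotropicGaussianField.memLp_two
    (hξ : IsHomogeneousIsotropicGaussianField ξ P) (x : Plane) : MemLp (ξ x) 2 P :=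
  (hξ.gaussian.hasGaussianLaw_eval x).memLp_two

lemma radialCovariance_zero (hcov : HasRegularlyVaryingCovariance ξ P α L) :
    radialCovariance ξ P 0 = 1 := by
  have h : planePoint (0, 0) = (0 : Plane) := by
    ext i; fin_cases i <;> simp [planePoint]
  rw [radialCovariance, h, hcov.cov_zero]

lemma IsHomogeneousIsotropicGaussianField.integral_mul_self
    (hξ : IsHomogeneousIsotropicGaussianField ξ P)
    (hcov : HasRegularlyVaryingCovariance ξ P α L) (x : Plane) :
    ∫ ω, ξ x ω * ξ x ω ∂P = 1 := by
  rw [hξ.integral_mul_eq, dist_self, radialCovariance_zero hcov]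

lemma radialCovariance_eq (hcov : HasRegularlyVaryingCovariance ξ P α L) {r : ℝ} (hr : 0 < r) :
    radialCovariance ξ P r = r ^ (-α) * L r := by
  have h := dist_zero_planePoint r
  rw [abs_of_pos hr, dist_zero_left] at h
  have h0 : planePoint (r, 0) ≠ 0 := norm_pos_iff.1 (by rw [h]; exact hr)
  rw [radialCovariance, hcov.cov_eq _ h0, h]

/-- The covariance is continuous, by mean square continuity and the Cauchy–Schwarz inequality. -/
lemma continuous_radialCovariance (hξ : IsHomogeneousIsotropicGaussianField ξ P)
    (hcov : HasRegularlyVaryingCovariance ξ P α L) : Continuous (radialCovariance ξ P) := by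
  rw [continuous_iff_continuousAt]
  intro s
  have hp : Tendsto (fun r : ℝ => planePoint (r, 0)) (𝓝 s) (𝓝 (planePoint (s, 0))) :=
    (continuous_planePoint.comp (by fun_prop : Continuous fun r : ℝ => (r, (0 : ℝ)))).tendsto s
  have h1 := (hξ.meanSquare_continuous (planePoint (s, 0))).comp hp
  have h2 : Tendsto (fun r => (radialCovariance ξ P r - radialCovariance ξ P s) ^ 2) (𝓝 s)
      (𝓝 0) := by
    refine squeeze_zero (fun r => sq_nonneg _) (fun r => ?_) h1
    have h3 := sq_integral_mul_le (hξ.memLp_two 0)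
      ((hξ.memLp_two (planePoint (r, 0))).sub (hξ.memLp_two (planePoint (s, 0)))) hcov.cov_zero
    simp only [Pi.sub_apply, mul_sub] at h3
    have i1 : ∀ x, Integrable (fun ω => ξ 0 ω * ξ x ω) P :=
      fun x => (hξ.memLp_two 0).integrable_mul (hξ.memLp_two x)
    rwa [integral_sub (i1 _) (i1 _)] at h3
  rw [ContinuousAt, tendsto_iff_dist_tendsto_zero]
  have h4 := h2.sqrt
  simpa [Real.sqrt_sq_eq_abs, Real.dist_eq] using h4

lemma isRegularlyVaryingCorrelation_radialCovariance
    (hξ : IsHomogeneousIsotropicGaussianField ξ P)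
    (hcov : HasRegularlyVaryingCovariance ξ P α L) :
    IsRegularlyVaryingCorrelation (radialCovariance ξ P) α L where
  exponent_pos := hcov.exponent_pos
  slowlyVarying := hcov.slowlyVarying
  continuous := continuous_radialCovariance hξ hcov
  nonneg r hr := by
    rcases hr.eq_or_lt with rfl | hr
    · rw [radialCovariance_zero hcov]; exact zero_le_one
    · rw [radialCovariance_eq hcov hr]
      exact mul_nonneg (Real.rpow_nonneg hr.le _) (hcov.slowlyVarying.pos r hr).le
  le_one r := by
    have h := sq_integral_mul_le (hξ.memLp_two 0) (hξ.memLp_two (planePoint (r, 0))) hcov.cov_zero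
    simp only [pow_two (ξ _ _)] at h
    rw [hξ.integral_mul_self hcov] at h
    exact (le_abs_self _).trans (abs_le_one_iff_mul_self_le_one.2 (by rwa [← pow_two]))
  eq_of_pos _ hr := radialCovariance_eq hcov hr

lemma integral_hermite_mul_hermite_field [IsProbabilityMeasure P]
    (hξ : IsHomogeneousIsotropicGaussianField ξ P)
    (hcov : HasRegularlyVaryingCovariance ξ P α L) (m : ℕ) (x y : Plane) :
    ∫ ω, (hermiteReal m).eval (ξ x ω) * (hermiteReal m).eval (ξ y ω) ∂P
      = m.factorial * radialCovariance ξ P (dist x y) ^ m := by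
  rw [integral_hermite_mul_hermite hξ.gaussian.hasGaussianLaw_prodMk (hξ.mean_zero x)
    (hξ.integral_mul_self hcov x), hξ.integral_mul_eq]

variable {m : ℕ} {g gstar : ℝ → ℝ → ℝ}

/-- The random function `t ↦ g(π t) H_m(ξ(π t))` on the set `S`, extended by zero. -/
noncomputable def sampledHermite {Ω : Type*} (m : ℕ) (g : ℝ → ℝ → ℝ) (ξ : Plane → Ω → ℝ)
    (S : Set (ℝ × ℝ)) (π : ℝ × ℝ → ℝ × ℝ) (t : ℝ × ℝ) (ω : Ω) : ℝ :=
  sampledWeight g S π t * (hermiteReal m).eval (ξ (planePoint (π t)) ω)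

lemma measurable_sampledHermite (hξ : IsHomogeneousIsotropicGaussianField ξ P)
    (hg : IsAdmissibleWeight m α L g gstar) {S : Set (ℝ × ℝ)} (hS : MeasurableSet S)
    {π : ℝ × ℝ → ℝ × ℝ} (hπ : IsSampling π) :
    Measurable (Function.uncurry (sampledHermite m g ξ S π)) := by
  have h1 : Measurable (fun p : (ℝ × ℝ) × Ω => ξ (planePoint (π p.1)) p.2) :=
    hξ.measurable.comp ((continuous_planePoint.measurable.comp
      (hπ.measurable.comp measurable_fst)).prodMk measurable_snd)
  exact ((measurable_sampledWeight hg hS hπ).comp measurable_fst).mul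
    ((hermiteReal m).continuous.measurable.comp h1)

lemma memLp_sampledHermite [IsProbabilityMeasure P]
    (hξ : IsHomogeneousIsotropicGaussianField ξ P) (S : Set (ℝ × ℝ))
    (π : ℝ × ℝ → ℝ × ℝ) (t : ℝ × ℝ) : MemLp (sampledHermite m g ξ S π t) 2 P :=
  (memLp_eval_of_hasGaussianLaw (hξ.gaussian.hasGaussianLaw_eval _) _ (by simp)).const_mul _

lemma integral_sampledHermite_mul [IsProbabilityMeasure P]
    (hξ : IsHomogeneousIsotropicGaussianField ξ P)
    (hcov : HasRegularlyVaryingCovariance ξ P α L) (S S' : Set (ℝ × ℝ))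
    (π π' : ℝ × ℝ → ℝ × ℝ) (t t' : ℝ × ℝ) :
    ∫ ω, sampledHermite m g ξ S π t ω * sampledHermite m g ξ S' π' t' ω ∂P
      = m.factorial * (sampledWeight g S π t * sampledWeight g S' π' t'
        * radialCovariance ξ P (euclidDist (π t) (π' t')) ^ m) := by
  have h := integral_hermite_mul_hermite_field hξ hcov m (planePoint (π t)) (planePoint (π' t'))
  have e : ∀ ω, sampledHermite m g ξ S π t ω * sampledHermite m g ξ S' π' t' ω
      = (sampledWeight g S π t * sampledWeight g S' π' t')
        * ((hermiteReal m).eval (ξ (planePoint (π t)) ω)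
          * (hermiteReal m).eval (ξ (planePoint (π' t')) ω)) := fun ω => by
    simp only [sampledHermite]; ring
  simp_rw [e]
  rw [integral_const_mul, h, euclidDist]
  ring

lemma sampledWeight_bounded (hg : IsAdmissibleWeight m α L g gstar) {S : Set (ℝ × ℝ)} {T : ℝ}
    (hST : S ⊆ Icc 0 (T, T)) {π : ℝ × ℝ → ℝ × ℝ} (hπ : IsSampling π) :
    ∃ M, ∀ t, |sampledWeight g S π t| ≤ M := by
  obtain ⟨M, hM⟩ := hg.exists_abs_le T
  refine ⟨max M 0, fun t => ?_⟩
  by_cases ht : t ∈ S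
  · have h := hST ht
    rw [sampledWeight, indicator_of_mem ht]
    exact (hM _ (hπ.nonneg t h.1) ((hπ.le_self t h.1).trans h.2)).trans (le_max_left _ _)
  · rw [sampledWeight, indicator_of_notMem ht, abs_zero]
    exact le_max_right _ _

lemma exists_integral_sampledHermite_sq_le [IsProbabilityMeasure P]
    (hξ : IsHomogeneousIsotropicGaussianField ξ P)
    (hcov : HasRegularlyVaryingCovariance ξ P α L) (hg : IsAdmissibleWeight m α L g gstar)
    {S : Set (ℝ × ℝ)} {T : ℝ} (hST : S ⊆ Icc 0 (T, T)) {π : ℝ × ℝ → ℝ × ℝ}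
    (hπ : IsSampling π) : ∃ K, ∀ t, ∫ ω, sampledHermite m g ξ S π t ω ^ 2 ∂P ≤ K := by
  obtain ⟨M, hM⟩ := sampledWeight_bounded hg hST hπ
  refine ⟨m.factorial * M ^ 2, fun t => ?_⟩
  have h := integral_sampledHermite_mul (m := m) (g := g) hξ hcov S S π π t t
  simp only [← pow_two] at h
  rw [h, euclidDist, dist_self, radialCovariance_zero hcov, one_pow, mul_one, ← sq_abs]
  gcongr
  exact hM t

/-- The integral over the plane of the sampled random function, i.e. the integral of
`g(π t) H_m(ξ(π t))` over `S`. -/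
noncomputable def sampledFunctional {Ω : Type*} (m : ℕ) (g : ℝ → ℝ → ℝ) (ξ : Plane → Ω → ℝ)
    (S : Set (ℝ × ℝ)) (π : ℝ × ℝ → ℝ × ℝ) (ω : Ω) : ℝ :=
  ∫ t, sampledHermite m g ξ S π t ω

lemma sampledFunctional_eq_setIntegral {Ω : Type*} {ξ : Plane → Ω → ℝ} {S : Set (ℝ × ℝ)} {T : ℝ}
    (hST : S ⊆ Icc 0 (T, T)) (π : ℝ × ℝ → ℝ × ℝ) (ω : Ω) :
    sampledFunctional m g ξ S π ω = ∫ t in Icc 0 (T, T), sampledHermite m g ξ S π t ω :=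
  (setIntegral_eq_integral_of_forall_compl_eq_zero fun t ht => by
    rw [sampledHermite, sampledWeight, indicator_of_notMem fun h => ht (hST h), zero_mul]).symm

lemma memLp_sampledFunctional [IsProbabilityMeasure P]
    (hξ : IsHomogeneousIsotropicGaussianField ξ P)
    (hcov : HasRegularlyVaryingCovariance ξ P α L) (hg : IsAdmissibleWeight m α L g gstar)
    {S : Set (ℝ × ℝ)} (hS : MeasurableSet S) {T : ℝ} (hST : S ⊆ Icc 0 (T, T))
    {π : ℝ × ℝ → ℝ × ℝ} (hπ : IsSampling π) : MemLp (sampledFunctional m g ξ S π) 2 P := by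
  obtain ⟨K, hK⟩ := exists_integral_sampledHermite_sq_le hξ hcov hg hST hπ
  have : IsFiniteMeasure ((volume : Measure (ℝ × ℝ)).restrict (Icc 0 (T, T))) :=
    ⟨by rw [Measure.restrict_apply_univ]; exact isCompact_Icc.measure_lt_top⟩
  have h := memLp_two_integral (μ := (volume : Measure (ℝ × ℝ)).restrict (Icc 0 (T, T)))
    (measurable_sampledHermite hξ hg hS hπ) (memLp_sampledHermite hξ S π) hK
  simpa only [← sampledFunctional_eq_setIntegral hST] using h

lemma integral_sampledFunctional_mul [IsProbabilityMeasure P]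
    (hξ : IsHomogeneousIsotropicGaussianField ξ P)
    (hcov : HasRegularlyVaryingCovariance ξ P α L) (hg : IsAdmissibleWeight m α L g gstar)
    {S S' : Set (ℝ × ℝ)} (hS : MeasurableSet S) (hS' : MeasurableSet S') {T : ℝ}
    (hST : S ⊆ Icc 0 (T, T)) (hST' : S' ⊆ Icc 0 (T, T)) {π π' : ℝ × ℝ → ℝ × ℝ}
    (hπ : IsSampling π) (hπ' : IsSampling π') :
    ∫ ω, sampledFunctional m g ξ S π ω * sampledFunctional m g ξ S' π' ω ∂P
      = m.factorial * ∫ z in Icc 0 (T, T) ×ˢ Icc 0 (T, T),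
        sampledWeight g S π z.1 * sampledWeight g S' π' z.2
          * radialCovariance ξ P (euclidDist (π z.1) (π' z.2)) ^ m := by
  obtain ⟨K, hK⟩ := exists_integral_sampledHermite_sq_le hξ hcov hg hST hπ
  obtain ⟨K', hK'⟩ := exists_integral_sampledHermite_sq_le hξ hcov hg hST' hπ'
  have : IsFiniteMeasure ((volume : Measure (ℝ × ℝ)).restrict (Icc 0 (T, T))) :=
    ⟨by rw [Measure.restrict_apply_univ]; exact isCompact_Icc.measure_lt_top⟩
  have h := integral_integral_mul_integral
    (μ := (volume : Measure (ℝ × ℝ)).restrict (Icc 0 (T, T)))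
    (measurable_sampledHermite hξ hg hS hπ) (measurable_sampledHermite hξ hg hS' hπ')
    (memLp_sampledHermite hξ S π) (memLp_sampledHermite hξ S' π') (K := max K K')
    (fun t => (hK t).trans (le_max_left _ _)) (fun t => (hK' t).trans (le_max_right _ _))
  simp only [← sampledFunctional_eq_setIntegral hST,
    ← sampledFunctional_eq_setIntegral hST'] at h
  rw [h, Measure.prod_restrict, ← Measure.volume_eq_prod, ← integral_const_mul]
  congr 1 with z
  exact integral_sampledHermite_mul hξ hcov S S' π π' z.1 z.2

end Field

open Pointwise in
lemma setIntegral_square_eq_scaled (f : (ℝ × ℝ) × (ℝ × ℝ) → ℝ) {T : ℝ} (hT : 0 < T) :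
    ∫ z in Icc 0 (T, T) ×ˢ Icc 0 (T, T), f z
      = T ^ 4 * ∫ z in unitSquare ×ˢ unitSquare, f (T • z) := by
  have hset : T • (unitSquare ×ˢ unitSquare) = Icc (0 : ℝ × ℝ) (T, T) ×ˢ Icc 0 (T, T) := by
    ext z
    have hk : ∀ p : ℝ × ℝ, T⁻¹ • p ∈ unitSquare ↔ p ∈ Icc 0 (T, T) := by
      intro p
      simp only [mem_unitSquare_iff, mem_Icc, Prod.le_def, Prod.smul_fst, Prod.smul_snd,
        Prod.fst_zero, Prod.snd_zero, Prod.fst_one, Prod.snd_one, smul_eq_mul,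
        inv_mul_le_iff₀ hT, mul_one, mul_nonneg_iff_of_pos_left (inv_pos.2 hT)]
    rw [mem_smul_set_iff_inv_smul_mem₀ hT.ne', mem_prod, mem_prod, Prod.smul_fst, Prod.smul_snd,
      hk, hk]
  have hr : Module.finrank ℝ ((ℝ × ℝ) × (ℝ × ℝ)) = 4 := by simp
  have hH : (volume : Measure (ℝ × ℝ)).IsAddHaarMeasure :=
    Measure.prod.instIsAddHaarMeasure volume volume
  have : (volume : Measure ((ℝ × ℝ) × (ℝ × ℝ))).IsAddHaarMeasure :=
    Measure.prod.instIsAddHaarMeasure volume volume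
  rw [Measure.setIntegral_comp_smul_of_pos volume f _ hT, hset, hr, smul_eq_mul,
    mul_inv_cancel_left₀ (pow_pos hT 4).ne']

open IsRegularlyVaryingCorrelation in
/-- The expected product of two sampled functionals, divided by the normalization, is a quadratic
form in the rescaled covariance kernel. -/
lemma integral_sampledFunctional_mul_div {Ω : Type*} [MeasurableSpace Ω] {P : Measure Ω}
    [IsProbabilityMeasure P] {ξ : Plane → Ω → ℝ} {α : ℝ} {L : ℝ → ℝ} {m : ℕ}
    {g gstar : ℝ → ℝ → ℝ} (hξ : IsHomogeneousIsotropicGaussianField ξ P)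
    (hcov : HasRegularlyVaryingCovariance ξ P α L) (hg : IsAdmissibleWeight m α L g gstar)
    {S S' : Set (ℝ × ℝ)} (hS : MeasurableSet S) (hS' : MeasurableSet S') {T : ℝ}
    (hST : S ⊆ Icc 0 (T, T)) (hST' : S' ⊆ Icc 0 (T, T)) {π π' : ℝ × ℝ → ℝ × ℝ}
    (hπ : IsSampling π) (hπ' : IsSampling π') (hT : 0 < T) :
    (∫ ω, sampledFunctional m g ξ S π ω * sampledFunctional m g ξ S' π' ω ∂P)
        / (T ^ (4 - α * m) * g T T ^ 2 * L T ^ m)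
      = m.factorial * ∫ z in unitSquare ×ˢ unitSquare,
        (sampledWeight g S π (T • z.1) / g T T) * (sampledWeight g S' π' (T • z.2) / g T T)
          * rescaled (radialCovariance ξ P) α L T
            (euclidDist (T⁻¹ • π (T • z.1)) (T⁻¹ • π' (T • z.2))) ^ m := by
  rw [integral_sampledFunctional_mul hξ hcov hg hS hS' hST hST' hπ hπ',
    setIntegral_square_eq_scaled _ hT, mul_div_assoc, mul_div_right_comm, ← integral_const_mul]
  congr 2 with z
  have e1 : T * euclidDist (T⁻¹ • π (T • z.1)) (T⁻¹ • π' (T • z.2))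
      = euclidDist (π (T • z.1)) (π' (T • z.2)) := by
    rw [euclidDist_smul (inv_nonneg.2 hT.le), mul_inv_cancel_left₀ hT.ne']
  have e2 : T ^ (4 - α * m) = T ^ 4 / (T ^ α) ^ m := by
    rw [Real.rpow_sub hT, Real.rpow_mul_natCast hT.le]
    norm_cast
  have h1 : T ^ α ≠ 0 := (Real.rpow_pos_of_pos hT α).ne'
  have h2 := (hcov.slowlyVarying.pos T hT).ne'
  rw [rescaled, e1, e2, Prod.smul_fst, Prod.smul_snd, div_pow, mul_pow]
  by_cases h3 : g T T = 0
  · simp [h3]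
  · field_simp

/-! ### The integral and the lattice sum as sampled functionals -/

lemma weightedHermite_eq {Ω : Type*} (m : ℕ) (g : ℝ → ℝ → ℝ) (ξ : Plane → Ω → ℝ) (t : ℝ × ℝ)
    (ω : Ω) :
    weightedHermite m g ξ t.1 t.2 ω
      = g t.1 t.2 * (hermiteReal m).eval (ξ (planePoint t) ω) := by
  rw [weightedHermite, aeval_hermite_eq_eval, planePoint]

lemma sampledHermite_of_mem {Ω : Type*} {m : ℕ} {g : ℝ → ℝ → ℝ} {ξ : Plane → Ω → ℝ}
    {S : Set (ℝ × ℝ)} {π : ℝ × ℝ → ℝ × ℝ} {t : ℝ × ℝ} (ht : t ∈ S) (ω : Ω) :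
    sampledHermite m g ξ S π t ω = weightedHermite m g ξ (π t).1 (π t).2 ω := by
  rw [sampledHermite, sampledWeight, indicator_of_mem ht, weightedHermite_eq]

/-- The integral of a sampled random function, as an integral over the sampling set. -/
lemma sampledFunctional_eq {Ω : Type*} {m : ℕ} {g : ℝ → ℝ → ℝ} {ξ : Plane → Ω → ℝ}
    {S : Set (ℝ × ℝ)} (hS : MeasurableSet S) (π : ℝ × ℝ → ℝ × ℝ) (ω : Ω) :
    sampledFunctional m g ξ S π ω
      = ∫ t in S, weightedHermite m g ξ (π t).1 (π t).2 ω := by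
  rw [sampledFunctional, ← setIntegral_eq_integral_of_forall_compl_eq_zero (s := S)]
  · exact setIntegral_congr_fun hS fun t ht => sampledHermite_of_mem ht ω
  · intro t ht
    rw [sampledHermite, sampledWeight, indicator_of_notMem ht, zero_mul]

/-- The union of the unit lattice cells used by the lattice sum. -/
def cellRectangle (T₁ T₂ : ℝ) : Set (ℝ × ℝ) :=
  Ico 0 ((⌊T₁⌋₊ : ℕ) : ℝ) ×ˢ Ico 0 ((⌊T₂⌋₊ : ℕ) : ℝ)

lemma measurableSet_cellRectangle (T₁ T₂ : ℝ) : MeasurableSet (cellRectangle T₁ T₂) :=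
  measurableSet_Ico.prod measurableSet_Ico

/-- The integral over a union of lattice cells of a function of the lower left corner is a sum. -/
lemma setIntegral_floor (f : ℝ → ℝ → ℝ) (n k : ℕ) :
    ∫ t in Ico (0 : ℝ) n ×ˢ Ico (0 : ℝ) k, f ⌊t.1⌋₊ ⌊t.2⌋₊
      = ∑ i ∈ Finset.range n, ∑ j ∈ Finset.range k, f i j := by
  let cell : ℕ × ℕ → Set (ℝ × ℝ) := fun q =>
    Ico (q.1 : ℝ) (q.1 + 1) ×ˢ Ico (q.2 : ℝ) (q.2 + 1)
  have hfl : ∀ (x : ℝ) (i : ℕ), x ∈ Ico (i : ℝ) (i + 1) → ⌊x⌋₊ = i := fun x i hx =>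
    (Nat.floor_eq_iff ((Nat.cast_nonneg i).trans hx.1)).2 hx
  have hcell : ∀ q, MeasurableSet (cell q) := fun q => measurableSet_Ico.prod measurableSet_Ico
  have hconst : ∀ q, EqOn (fun t : ℝ × ℝ => f ⌊t.1⌋₊ ⌊t.2⌋₊) (fun _ => f q.1 q.2) (cell q) := by
    intro q t ht
    simp only [hfl t.1 q.1 ht.1, hfl t.2 q.2 ht.2]
  have hvol : ∀ q, (volume : Measure (ℝ × ℝ)) (cell q) = 1 := by
    intro q
    simp [cell, Measure.volume_eq_prod, Measure.prod_prod]
  have hU : Ico (0 : ℝ) n ×ˢ Ico (0 : ℝ) k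
      = ⋃ q ∈ Finset.range n ×ˢ Finset.range k, cell q := by
    have h1 : ∀ (x : ℝ) (n : ℕ), x ∈ Ico (0 : ℝ) n → ⌊x⌋₊ < n ∧ x ∈ Ico (⌊x⌋₊ : ℝ) (⌊x⌋₊ + 1) :=
      fun x n hx => ⟨(Nat.floor_lt hx.1).2 hx.2, Nat.floor_le hx.1, Nat.lt_floor_add_one x⟩
    have h2 : ∀ (x : ℝ) (i n : ℕ), i < n → x ∈ Ico (i : ℝ) (i + 1) → x ∈ Ico (0 : ℝ) n :=
      fun x i n hi hx => ⟨(Nat.cast_nonneg i).trans hx.1, hx.2.trans_le (by exact_mod_cast hi)⟩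
    ext t
    simp only [mem_iUnion, Finset.mem_product, Finset.mem_range, exists_prop]
    constructor
    · rintro ⟨ht1, ht2⟩
      exact ⟨(⌊t.1⌋₊, ⌊t.2⌋₊), ⟨(h1 _ _ ht1).1, (h1 _ _ ht2).1⟩, (h1 _ _ ht1).2, (h1 _ _ ht2).2⟩
    · rintro ⟨q, ⟨hq1, hq2⟩, ht1, ht2⟩
      exact ⟨h2 _ _ _ hq1 ht1, h2 _ _ _ hq2 ht2⟩
  rw [hU, integral_biUnion_finset _ (fun q _ => hcell q), Finset.sum_product]
  · refine Finset.sum_congr rfl fun i _ => Finset.sum_congr rfl fun j _ => ?_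
    rw [setIntegral_congr_fun (hcell (i, j)) (hconst (i, j)), setIntegral_const, measureReal_def,
      hvol]
    simp
  · intro q _ q' _ hne
    refine Set.disjoint_left.2 fun t ht ht' => hne ?_
    exact Prod.ext ((hfl _ _ ht.1).symm.trans (hfl _ _ ht'.1))
      ((hfl _ _ ht.2).symm.trans (hfl _ _ ht'.2))
  · intro q _
    refine IntegrableOn.congr_fun (integrableOn_const (by simp [hvol])) (hconst q).symm (hcell q)

lemma sampledFunctional_cellRectangle {Ω : Type*} (m : ℕ) (g : ℝ → ℝ → ℝ) (ξ : Plane → Ω → ℝ)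
    (T₁ T₂ : ℝ) (ω : Ω) :
    sampledFunctional m g ξ (cellRectangle T₁ T₂) cellCorner ω
      = additiveFunctional m g ξ T₁ T₂ ω := by
  rw [sampledFunctional_eq (measurableSet_cellRectangle T₁ T₂)]
  exact setIntegral_floor (fun x y => weightedHermite m g ξ x y ω) ⌊T₁⌋₊ ⌊T₂⌋₊

lemma rectangle_subset (T₁ T₂ : ℝ) :
    Icc 0 T₁ ×ˢ Icc 0 T₂ ⊆ Icc (0 : ℝ × ℝ) (max T₁ T₂, max T₁ T₂) := by
  rintro t ⟨⟨h1, h2⟩, h3, h4⟩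
  exact ⟨⟨h1, h3⟩, h2.trans (le_max_left _ _), h4.trans (le_max_right _ _)⟩

lemma cellRectangle_subset {T₁ T₂ : ℝ} (h₁ : 0 ≤ T₁) (h₂ : 0 ≤ T₂) :
    cellRectangle T₁ T₂ ⊆ Icc (0 : ℝ × ℝ) (max T₁ T₂, max T₁ T₂) := by
  refine Subset.trans (fun t ht => ?_) (rectangle_subset T₁ T₂)
  exact ⟨⟨ht.1.1, ht.1.2.le.trans (Nat.floor_le h₁)⟩, ht.2.1, ht.2.2.le.trans (Nat.floor_le h₂)⟩

section Field

variable {Ω : Type*} [MeasurableSpace Ω] {P : Measure Ω} [IsProbabilityMeasure P]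
  {ξ : Plane → Ω → ℝ} {α : ℝ} {L : ℝ → ℝ} {m : ℕ} {g gstar : ℝ → ℝ → ℝ}

lemma ae_integrableOn_weightedHermite (hξ : IsHomogeneousIsotropicGaussianField ξ P)
    (hcov : HasRegularlyVaryingCovariance ξ P α L) (hg : IsAdmissibleWeight m α L g gstar)
    (T₁ T₂ : ℝ) :
    ∀ᵐ ω ∂P, IntegrableOn (fun t : ℝ × ℝ => weightedHermite m g ξ t.1 t.2 ω)
      (Icc 0 T₁ ×ˢ Icc 0 T₂) := by
  have hS : MeasurableSet (Icc 0 T₁ ×ˢ Icc 0 T₂) := measurableSet_Icc.prod measurableSet_Icc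
  obtain ⟨K, hK⟩ := exists_integral_sampledHermite_sq_le hξ hcov hg (rectangle_subset T₁ T₂)
    isSampling_id
  have : IsFiniteMeasure ((volume : Measure (ℝ × ℝ)).restrict (Icc 0 T₁ ×ˢ Icc 0 T₂)) :=
    ⟨by rw [Measure.restrict_apply_univ]; exact (isCompact_Icc.prod isCompact_Icc).measure_lt_top⟩
  filter_upwards [ae_integrable_of_bounded_second_moment
    (μ := (volume : Measure (ℝ × ℝ)).restrict (Icc 0 T₁ ×ˢ Icc 0 T₂))
    (measurable_sampledHermite hξ hg hS isSampling_id) (memLp_sampledHermite hξ _ _) hK] with ω hω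
  exact IntegrableOn.congr_fun hω (fun t ht => sampledHermite_of_mem ht ω) hS

lemma ae_sampledFunctional_eq_integralFunctional
    (hξ : IsHomogeneousIsotropicGaussianField ξ P)
    (hcov : HasRegularlyVaryingCovariance ξ P α L) (hg : IsAdmissibleWeight m α L g gstar)
    {T₁ T₂ : ℝ} (h₁ : 0 ≤ T₁) (h₂ : 0 ≤ T₂) :
    sampledFunctional m g ξ (Icc 0 T₁ ×ˢ Icc 0 T₂) id
      =ᵐ[P] integralFunctional m g ξ T₁ T₂ := by
  filter_upwards [ae_integrableOn_weightedHermite hξ hcov hg T₁ T₂] with ω hω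
  rw [sampledFunctional_eq (measurableSet_Icc.prod measurableSet_Icc), integralFunctional,
    intervalIntegral.integral_of_le h₁, ← integral_Icc_eq_integral_Ioc]
  simp only [id]
  rw [Measure.volume_eq_prod] at hω ⊢
  rw [setIntegral_prod _ hω]
  refine setIntegral_congr_fun measurableSet_Icc fun t _ => ?_
  simp only
  rw [intervalIntegral.integral_of_le h₂, ← integral_Icc_eq_integral_Ioc]

/-! ### The limit -/

lemma eventually_mul_mem_iff {ι : Type*} {l : Filter ι} {T τ : ι → ℝ} (hT : Tendsto T l atTop)
    {a x : ℝ} (hτ : Tendsto (fun i => τ i / T i) l (𝓝 a)) (hx : 0 ≤ x) (hxa : x ≠ a) :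
    ∀ᶠ i in l, (T i * x ∈ Icc 0 (τ i) ↔ x < a) ∧ (T i * x ∈ Ico 0 (τ i) ↔ x < a) := by
  rcases hxa.lt_or_gt with h | h
  · filter_upwards [hτ.eventually_const_lt h, hT.eventually_gt_atTop 0] with i h1 h2
    have h3 := mul_nonneg h2.le hx
    rw [lt_div_iff₀ h2, mul_comm] at h1
    simp [h, h3, h1, h1.le]
  · filter_upwards [hτ.eventually_lt_const h, hT.eventually_gt_atTop 0] with i h1 h2
    rw [div_lt_iff₀ h2, mul_comm] at h1
    simp [h.not_gt, h1.not_ge, h1.not_gt]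

lemma tendsto_floor_div {ι : Type*} {l : Filter ι} {T τ : ι → ℝ} (hT : Tendsto T l atTop)
    (hτ0 : ∀ i, 0 ≤ τ i) {a : ℝ} (hτ : Tendsto (fun i => τ i / T i) l (𝓝 a)) :
    Tendsto (fun i => ((⌊τ i⌋₊ : ℕ) : ℝ) / T i) l (𝓝 a) := by
  have h1 : Tendsto (fun i => τ i / T i - (T i)⁻¹) l (𝓝 a) := by
    have := hτ.sub hT.inv_tendsto_atTop
    simpa using this
  refine tendsto_of_tendsto_of_tendsto_of_le_of_le' h1 hτ ?_ ?_
  · filter_upwards [hT.eventually_gt_atTop 0] with i hi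
    rw [← one_div, ← sub_div]
    gcongr
    linarith [Nat.lt_floor_add_one (τ i)]
  · filter_upwards [hT.eventually_gt_atTop 0] with i hi
    gcongr
    exact Nat.floor_le (hτ0 i)

/-- The normalized mean square difference tends to zero along a countably generated filter, as
dominated convergence requires. -/
lemma tendsto_normalized_integral_sq {ι : Type*} {l : Filter ι} [l.IsCountablyGenerated]
    (hξ : IsHomogeneousIsotropicGaussianField ξ P)
    (hcov : HasRegularlyVaryingCovariance ξ P α L) (hg : IsAdmissibleWeight m α L g gstar)
    (hm : 1 ≤ m) (hα : α < 2 / (m : ℝ)) {T₁ T₂ : ι → ℝ}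
    (hT₁ : ∀ s, 0 ≤ T₁ s) (hT₂ : ∀ s, 0 ≤ T₂ s)
    (hT : Tendsto (fun s => max (T₁ s) (T₂ s)) l atTop) {a₁ a₂ : ℝ}
    (h₁ : Tendsto (fun s => T₁ s / max (T₁ s) (T₂ s)) l (𝓝 a₁))
    (h₂ : Tendsto (fun s => T₂ s / max (T₁ s) (T₂ s)) l (𝓝 a₂)) :
    Tendsto (fun s =>
        (∫ ω, (integralFunctional m g ξ (T₁ s) (T₂ s) ω
          - additiveFunctional m g ξ (T₁ s) (T₂ s) ω) ^ 2 ∂P) /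
        (max (T₁ s) (T₂ s) ^ (4 - α * m) *
          g (max (T₁ s) (T₂ s)) (max (T₁ s) (T₂ s)) ^ 2 *
          L (max (T₁ s) (T₂ s)) ^ m))
      l (𝓝 0) := by
  set T : ι → ℝ := fun s => max (T₁ s) (T₂ s) with hTdef
  set S : ι → Set (ℝ × ℝ) := fun s => Icc 0 (T₁ s) ×ˢ Icc 0 (T₂ s) with hSdef
  set S' : ι → Set (ℝ × ℝ) := fun s => cellRectangle (T₁ s) (T₂ s) with hSdef'
  have hSm : ∀ s, MeasurableSet (S s) := fun s => measurableSet_Icc.prod measurableSet_Icc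
  have hSm' : ∀ s, MeasurableSet (S' s) := fun s => measurableSet_cellRectangle _ _
  have hST : ∀ s, S s ⊆ Icc 0 (T s, T s) := fun s => rectangle_subset _ _
  have hST' : ∀ s, S' s ⊆ Icc 0 (T s, T s) := fun s => cellRectangle_subset (hT₁ s) (hT₂ s)
  -- both sampling sets, rescaled, converge to the rectangle with sides `a₁`, `a₂`
  set A : Set (ℝ × ℝ) := {u | u.1 < a₁ ∧ u.2 < a₂} with hA
  have hne := ae_restrict_of_ae (s := unitSquare) (ae_fst_ne_and_snd_ne (a₁, a₂))
  have hmem := ae_restrict_mem (μ := (volume : Measure (ℝ × ℝ))) measurableSet_unitSquare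
  have hSA : ∀ᵐ u ∂((volume : Measure (ℝ × ℝ)).restrict unitSquare),
      ∀ᶠ s in l, (T s • u ∈ S s ↔ u ∈ A) := by
    filter_upwards [hne, hmem] with u hu hu'
    filter_upwards [eventually_mul_mem_iff hT h₁ hu'.1.1 hu.1,
      eventually_mul_mem_iff hT h₂ hu'.2.1 hu.2] with s h3 h4
    exact and_congr h3.1 h4.1
  have hSA' : ∀ᵐ u ∂((volume : Measure (ℝ × ℝ)).restrict unitSquare),
      ∀ᶠ s in l, (T s • u ∈ S' s ↔ u ∈ A) := by
    filter_upwards [hne, hmem] with u hu hu'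
    filter_upwards [eventually_mul_mem_iff hT (tendsto_floor_div hT hT₁ h₁) hu'.1.1 hu.1,
      eventually_mul_mem_iff hT (tendsto_floor_div hT hT₂ h₂) hu'.2.1 hu.2] with s h3 h4
    exact and_congr h3.2 h4.2
  have hI := hg.isAsymptoticSampling hT isSampling_id hSm hSA
  have hI' := hg.isAsymptoticSampling hT isSampling_cellCorner hSm' hSA'
  have hc := isRegularlyVaryingCorrelation_radialCovariance hξ hcov
  have l1 := (hI.tendsto_integral hI hT hc hm hα).const_mul (m.factorial : ℝ)
  have l2 := (hI.tendsto_integral hI' hT hc hm hα).const_mul (m.factorial : ℝ)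
  have l3 := (hI'.tendsto_integral hI' hT hc hm hα).const_mul (m.factorial : ℝ)
  have l4 := (l1.sub (l2.const_mul 2)).add l3
  rw [show ∀ x : ℝ, x - 2 * x + x = 0 by intro x; ring] at l4
  refine l4.congr' ?_
  filter_upwards [hT.eventually_gt_atTop 0] with s hs
  rw [← integral_sampledFunctional_mul_div hξ hcov hg (hSm s) (hSm s) (hST s) (hST s)
      isSampling_id isSampling_id hs,
    ← integral_sampledFunctional_mul_div hξ hcov hg (hSm s) (hSm' s) (hST s) (hST' s)
      isSampling_id isSampling_cellCorner hs,
    ← integral_sampledFunctional_mul_div hξ hcov hg (hSm' s) (hSm' s) (hST' s) (hST' s)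
      isSampling_cellCorner isSampling_cellCorner hs, ← mul_div_assoc, ← sub_div, ← add_div]
  congr 1
  have m1 := memLp_sampledFunctional hξ hcov hg (hSm s) (hST s) isSampling_id
  have m2 := memLp_sampledFunctional hξ hcov hg (hSm' s) (hST' s) isSampling_cellCorner
  have i1 : Integrable (fun ω => sampledFunctional m g ξ (S s) id ω
    * sampledFunctional m g ξ (S s) id ω) P := m1.integrable_mul m1
  have i2 : Integrable (fun ω => sampledFunctional m g ξ (S s) id ω
    * sampledFunctional m g ξ (S' s) cellCorner ω) P := m1.integrable_mul m2
  have i3 : Integrable (fun ω => sampledFunctional m g ξ (S' s) cellCorner ω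
    * sampledFunctional m g ξ (S' s) cellCorner ω) P := m2.integrable_mul m2
  have i4 : Integrable (fun ω => sampledFunctional m g ξ (S s) id ω
    * sampledFunctional m g ξ (S s) id ω - 2 * (sampledFunctional m g ξ (S s) id ω
    * sampledFunctional m g ξ (S' s) cellCorner ω)) P := i1.sub (i2.const_mul 2)
  rw [← integral_const_mul, ← integral_sub i1 (i2.const_mul 2), ← integral_add i4 i3]
  refine integral_congr_ae ?_
  filter_upwards [ae_sampledFunctional_eq_integralFunctional hξ hcov hg (hT₁ s) (hT₂ s)] with ω hω
  rw [hω, sampledFunctional_cellRectangle]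
  ring

end Field

theorem theorem3 {Ω : Type*} [MeasurableSpace Ω] (P : Measure Ω) [IsProbabilityMeasure P]
    (ξ : Plane → Ω → ℝ) (m : ℕ) (hm : 1 ≤ m) (α : ℝ) (L : ℝ → ℝ) (g gstar : ℝ → ℝ → ℝ)
    (hξ : IsHomogeneousIsotropicGaussianField ξ P)
    (hcov : HasRegularlyVaryingCovariance ξ P α L)
    (hα : α < 2 / (m : ℝ))
    (hg : IsAdmissibleWeight m α L g gstar)
    {ι : Type*} (l : Filter ι) (T₁ T₂ : ι → ℝ)
    (hT₁ : ∀ s, 0 ≤ T₁ s) (hT₂ : ∀ s, 0 ≤ T₂ s)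
    (hT : Tendsto (fun s => max (T₁ s) (T₂ s)) l atTop)
    (hlim₁ : ∃ a₁ : ℝ, Tendsto (fun s => T₁ s / max (T₁ s) (T₂ s)) l (𝓝 a₁))
    (hlim₂ : ∃ a₂ : ℝ, Tendsto (fun s => T₂ s / max (T₁ s) (T₂ s)) l (𝓝 a₂)) :
    (∀ s,
      (∀ᵐ ω ∂P, IntegrableOn (fun t : ℝ × ℝ => weightedHermite m g ξ t.1 t.2 ω)
        (Icc 0 (T₁ s) ×ˢ Icc 0 (T₂ s))) ∧
      MemLp (fun ω => integralFunctional m g ξ (T₁ s) (T₂ s) ω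
        - additiveFunctional m g ξ (T₁ s) (T₂ s) ω) 2 P) ∧
    Tendsto (fun s =>
        (∫ ω, (integralFunctional m g ξ (T₁ s) (T₂ s) ω
          - additiveFunctional m g ξ (T₁ s) (T₂ s) ω) ^ 2 ∂P) /
        (max (T₁ s) (T₂ s) ^ (4 - α * m) *
          g (max (T₁ s) (T₂ s)) (max (T₁ s) (T₂ s)) ^ 2 *
          L (max (T₁ s) (T₂ s)) ^ m))
      l (𝓝 0) := by
  refine ⟨fun s => ⟨ae_integrableOn_weightedHermite hξ hcov hg _ _, ?_⟩, ?_⟩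
  · have m1 := memLp_sampledFunctional hξ hcov hg
      (measurableSet_Icc.prod measurableSet_Icc) (rectangle_subset (T₁ s) (T₂ s)) isSampling_id
    have m2 := memLp_sampledFunctional hξ hcov hg
      (measurableSet_cellRectangle _ _) (cellRectangle_subset (hT₁ s) (hT₂ s))
      isSampling_cellCorner
    refine (m1.sub m2).ae_eq ?_
    filter_upwards [ae_sampledFunctional_eq_integralFunctional hξ hcov hg (hT₁ s) (hT₂ s)]
      with ω hω
    rw [Pi.sub_apply, hω, sampledFunctional_cellRectangle]
  · obtain ⟨a₁, h₁⟩ := hlim₁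
    obtain ⟨a₂, h₂⟩ := hlim₂
    -- Dominated convergence needs a countably generated filter: use the coarsest filter on pairs
    -- of side lengths for which the hypotheses hold.
    let Q : Set (ℝ × ℝ) := {x | 0 ≤ x.1 ∧ 0 ≤ x.2}
    let M : Q → ℝ := fun x => max x.1.1 x.1.2
    let l' : Filter Q := comap M atTop ⊓ comap (fun x => x.1.1 / M x) (𝓝 a₁) ⊓
      comap (fun x => x.1.2 / M x) (𝓝 a₂)
    have key := tendsto_normalized_integral_sq (l := l') (T₁ := fun x : Q => x.1.1)
      (T₂ := fun x : Q => x.1.2) hξ hcov hg hm hα (fun x => x.2.1) (fun x => x.2.2)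
      (tendsto_comap.mono_left (inf_le_left.trans inf_le_left))
      (tendsto_comap.mono_left (inf_le_left.trans inf_le_right))
      (tendsto_comap.mono_left inf_le_right)
    have hl : Tendsto (fun s => (⟨(T₁ s, T₂ s), hT₁ s, hT₂ s⟩ : Q)) l l' :=
      tendsto_inf.2 ⟨tendsto_inf.2 ⟨tendsto_comap_iff.2 hT, tendsto_comap_iff.2 h₁⟩,
        tendsto_comap_iff.2 h₂⟩
    exact (key.comp hl).congr fun s => rfl
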